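/- Let $M,N\ge 0$ and let $\mathfrak s=s_1s_2\cdots s_{M+N}$ be an arbitrary $0^M1^N$-sequence, i.e. a sequence of $M$ zeros and $N$ ones in some order; write $|i|=s_i$. Let $Y=Y_{M|N}(\mathfrak s)$ be the super Yangian: the unital associative superalgebra over $\mathbb C$ generated by $t_{i,j}^{(r)}$ ($1\le i,j\le M+N$, $r\ge 1$), where $t_{i,j}^{(r)}$ has parity $|i|+|j|$ mod $2$, subject to $$[t_{i,j}^{(r)},t_{k,l}^{(q)}]=(-1)^{|i||j|+|i||k|+|j||k|}\sum_{a=0}^{\min(r,q)-1}\bigl(t_{k,j}^{(a)}t_{i,l}^{(r+q-1-a)}-t_{k,j}^{(r+q-1-a)}t_{i,l}^{(a)}\bigr),$$ where $[\cdot,\cdot]$ is the supercommutator and $t_{i,j}^{(0)}=\delta_{i,j}$. Put $t_{i,j}(u)=\sum_{r\ge 0}t_{i,j}^{(r)}u^{-r}\in Y[[u^{-1}]]$, $T(u)=(t_{i,j}(u))_{1\le i,j\le M+N}$ and $T(u)^{-1}=(t'_{i,j}(u))$. For a series $f(u)\in Y[[u^{-1}]]$ and $c\in\mathbb C$, $f(u+c)$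 is re-expanded in powers of $u^{-1}$. Let $T(u)=F(u)D(u)E(u)$ be the unique Gauss decomposition with $F(u)$ lower unitriangular, $D(u)=\mathrm{diag}(d_1(u),\dots,d_{M+N}(u))$ diagonal and $E(u)$ upper unitriangular over $Y[[u^{-1}]]$. Set $\tilde d_i(u)=d_i(u)$ if $s_i=0$ and $\tilde d_i(u)=d_i(u)^{-1}$ if $s_i=1$. Let $u_1=u+s_1$, and let $u_{i+1}=u_i-1$ if $s_i=s_{i+1}=0$, $u_{i+1}=u_i+1$ if $s_i=s_{i+1}=1$, and $u_{i+1}=u_i$ if $s_i\ne s_{i+1}$. Define $$b^{\mathfrak s}_{M|N}(u)=1+\sum_{r\ge 1}b^{\mathfrak s(r)}u^{-r}=\tilde d_1(u_1)\,\tilde d_2(u_2)\cdots\tilde d_{M+N}(u_{M+N}).$$ Let $i_1<\dots<i_M$ be the positions of the zeros and $j_1<\dots<j_N$ the positions of the ones in $\mathfrak s$, and define the quantum Berezinian $$\operatorname{qsdet}T^{\mathfrak s}(u)=\sum_{\rho\in S_M}\operatorname{sgn}(\rho)\,t_{i_{\rho(1)},i_1}(u)\,t_{i_{\rho(2)},i_2}(u-1)\cdots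 t_{i_{\rho(M)},i_M}(u-M+1)\times\sum_{\sigma\in S_N}\operatorname{sgn}(\sigma)\,t'_{j_1,j_{\sigma(1)}}(u-M+1)\cdots t'_{j_N,j_{\sigma(N)}}(u-M+N).$$ Then $b^{\mathfrak s}_{M|N}(u)=\operatorname{qsdet}T^{\mathfrak s}(u)$ in $Y[[u^{-1}]]$. In particular, the elements $b^{\mathfrak s(r)}$, $r\ge 1$, are central in $Y$. -/

import Mathlib

open PowerSeries

noncomputable section

/-! ### Power series in `u⁻¹`

A formal series `f(u) = ∑ f_r u^{-r}` with coefficients in a (noncommutative) ring `R` is an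
element of `R⟦X⟧`, the central variable `X` being `u⁻¹`. -/

namespace USeries

variable {R : Type*} [Ring R] [Algebra ℂ R]

/-- The expansion of `(u + c)⁻¹ = u⁻¹ (1 + c u⁻¹)⁻¹` as a power series in `X = u⁻¹`. -/
def shiftedVar (c : ℂ) : ℂ⟦X⟧ := X * (1 + C c * X)⁻¹

/-- `f(u) ↦ f(u + c) = ∑ f_r ((u + c)⁻¹) ^ r`, re-expanded in powers of `u⁻¹`. The coefficient of
`u^{-m}` is a finite sum, because `((u + c)⁻¹) ^ r` is divisible by `u^{-r}`. -/
def shift (c : ℂ) (f : R⟦X⟧) : R⟦X⟧ :=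
  PowerSeries.mk fun m =>
    ∑ r ∈ Finset.range (m + 1), PowerSeries.coeff m (shiftedVar c ^ r) • PowerSeries.coeff r f

end USeries

/-! ### Gauss decomposition of matrices over a noncommutative ring -/

/-- `A = F D E` with `F` lower unitriangular, `D` diagonal and `E` upper unitriangular. -/
structure IsGaussDecomposition {R : Type*} [Ring R] {n : ℕ}
    (A F D E : Matrix (Fin n) (Fin n) R) : Prop where
  lower_diag : ∀ i, F i i = 1
  lower_zero : ∀ i j, i < j → F i j = 0
  diag : D.IsDiag
  upper_diag : ∀ i, E i i = 1
  upper_zero : ∀ i j, j < i → E i j = 0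
  eq_mul : A = F * D * E

namespace USeries

variable {R : Type*} [Ring R]

lemma isUnit_of_constantCoeff_eq_one {f : R⟦X⟧} (h : constantCoeff f = 1) : IsUnit f := by
  rw [PowerSeries.isUnit_iff_constantCoeff, h]
  exact isUnit_one

/-- A matrix of power series is the same thing as a power series of matrices. -/
def matrixEquiv (ι : Type*) [Fintype ι] [DecidableEq ι] :
    Matrix ι ι R⟦X⟧ ≃* (Matrix ι ι R)⟦X⟧ where
  toFun A := PowerSeries.mk fun r => Matrix.of fun i j => coeff r (A i j)
  invFun B := Matrix.of fun i j => PowerSeries.mk fun r => coeff r B i j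
  left_inv A := by
    ext i j r
    simp
  right_inv B := by
    ext r i j
    simp
  map_mul' A B := by
    ext r i j
    simp only [coeff_mk, Matrix.of_apply, Matrix.mul_apply, map_sum, PowerSeries.coeff_mul,
      Matrix.sum_apply]
    rw [Finset.sum_comm]

lemma isUnit_matrix {ι : Type*} [Fintype ι] [DecidableEq ι] {A : Matrix ι ι R⟦X⟧}
    (h : ∀ i j, constantCoeff (A i j) = if i = j then 1 else 0) : IsUnit A := by
  rw [← MulEquiv.isUnit_map (matrixEquiv (R := R) ι), PowerSeries.isUnit_iff_constantCoeff]
  have : constantCoeff (matrixEquiv ι A) = 1 := by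
    ext i j
    rw [← PowerSeries.coeff_zero_eq_constantCoeff_apply]
    simp [matrixEquiv, h, Matrix.one_apply]
  rw [this]
  exact isUnit_one

/-- A matrix of power series that is congruent to the identity has a unique Gauss decomposition,
and the diagonal entries of its diagonal factor have constant term one. -/
theorem gauss {n : ℕ} (A : Matrix (Fin n) (Fin n) R⟦X⟧)
    (h : ∀ i j, constantCoeff (A i j) = if i = j then 1 else 0) :
    ∃ F D E, IsGaussDecomposition A F D E ∧ (∀ i, constantCoeff (D i i) = 1) ∧
      ∀ F' D' E', IsGaussDecomposition A F' D' E' → F' = F ∧ D' = D ∧ E' = E := by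
  induction n with
  | zero =>
    refine ⟨1, 1, 1, ⟨fun i => i.elim0, fun i => i.elim0, fun i => i.elim0, fun i => i.elim0,
      fun i => i.elim0, Subsingleton.elim _ _⟩, fun i => i.elim0, fun F' D' E' _ =>
      ⟨Subsingleton.elim _ _, Subsingleton.elim _ _, Subsingleton.elim _ _⟩⟩
  | succ n ih =>
    obtain ⟨a, ha⟩ := isUnit_of_constantCoeff_eq_one (f := A 0 0) (by simp [h])
    let S : Matrix (Fin n) (Fin n) R⟦X⟧ := Matrix.of fun i j =>
      A i.succ j.succ - A i.succ 0 * ↑a⁻¹ * A 0 j.succ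
    obtain ⟨F, D, E, hG, hD, hU⟩ := ih S (by
      intro i j
      simp [S, h, Fin.succ_ne_zero, Fin.succ_inj])
    let F₁ : Matrix (Fin (n + 1)) (Fin (n + 1)) R⟦X⟧ := Matrix.of fun i j =>
      Fin.cases (Fin.cases 1 (fun _ => 0) j)
        (fun i' => Fin.cases (A i'.succ 0 * ↑a⁻¹) (fun j' => F i' j') j) i
    let D₁ : Matrix (Fin (n + 1)) (Fin (n + 1)) R⟦X⟧ := Matrix.of fun i j =>
      Fin.cases (Fin.cases (A 0 0) (fun _ => 0) j)
        (fun i' => Fin.cases 0 (fun j' => D i' j') j) i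
    let E₁ : Matrix (Fin (n + 1)) (Fin (n + 1)) R⟦X⟧ := Matrix.of fun i j =>
      Fin.cases (Fin.cases 1 (fun j' => ↑a⁻¹ * A 0 j'.succ) j)
        (fun i' => Fin.cases 0 (fun j' => E i' j') j) i
    refine ⟨F₁, D₁, E₁, ⟨?_, ?_, ?_, ?_, ?_, ?_⟩, ?_, ?_⟩
    · intro i
      cases i using Fin.cases with
      | zero => simp [F₁]
      | succ i => simp [F₁, hG.lower_diag]
    · intro i j hij
      cases i using Fin.cases with
      | zero =>
        cases j using Fin.cases with
        | zero => simp at hij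
        | succ j => simp [F₁]
      | succ i =>
        cases j using Fin.cases with
        | zero => simp at hij
        | succ j => simpa [F₁] using hG.lower_zero i j (by simpa using hij)
    · intro i j hij
      cases i using Fin.cases with
      | zero =>
        cases j using Fin.cases with
        | zero => simp at hij
        | succ j => simp [D₁]
      | succ i =>
        cases j using Fin.cases with
        | zero => simp [D₁]
        | succ j => simpa [D₁] using hG.diag (fun hh => hij (by rw [hh]))
    · intro i
      cases i using Fin.cases with
      | zero => simp [E₁]
      | succ i => simp [E₁, hG.upper_diag]
    · intro i j hij
      cases i using Fin.cases with
      | zero => simp at hij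
      | succ i =>
        cases j using Fin.cases with
        | zero => simp [E₁]
        | succ j => simpa [E₁] using hG.upper_zero i j (by simpa using hij)
    · ext1 i j
      have hS := fun i j => congrFun (congrFun hG.eq_mul i) j
      simp only [Matrix.mul_apply] at hS
      simp only [Matrix.mul_apply, Fin.sum_univ_succ]
      cases i using Fin.cases with
      | zero =>
        cases j using Fin.cases with
        | zero => simp [F₁, D₁, E₁]
        | succ j => simp [F₁, D₁, E₁, ← ha]
      | succ i =>
        cases j using Fin.cases with
        | zero => simp [F₁, D₁, E₁, ← ha]
        | succ j =>
          simp only [F₁, D₁, E₁, Matrix.of_apply, Fin.cases_zero,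
            Fin.cases_succ, mul_zero, zero_add, Finset.sum_const_zero, add_zero]
          rw [← hS i j]
          simp [S, ← ha, mul_assoc]
    · intro i
      cases i using Fin.cases with
      | zero => simp [D₁, h]
      | succ i => simpa [D₁] using hD i
    · intro F' D' E' hG'
      have hS := fun i j => congrFun (congrFun hG'.eq_mul i) j
      have e1 : ∀ j : Fin n, F' 0 j.succ = 0 := fun j => hG'.lower_zero _ _ (Fin.succ_pos j)
      have e2 : ∀ j : Fin n, E' j.succ 0 = 0 := fun j => hG'.upper_zero _ _ (Fin.succ_pos j)
      have e3 : ∀ j : Fin n, D' 0 j.succ = 0 := fun j => hG'.diag (Fin.succ_ne_zero j).symm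
      have e4 : ∀ j : Fin n, D' j.succ 0 = 0 := fun j => hG'.diag (Fin.succ_ne_zero j)
      have e5 : F' 0 0 = 1 := hG'.lower_diag 0
      have e6 : E' 0 0 = 1 := hG'.upper_diag 0
      simp only [Matrix.mul_apply, Fin.sum_univ_succ] at hS
      have h00 : D' 0 0 = A 0 0 := by
        have := hS 0 0
        simpa [e1, e2, e3, e4, e5, e6] using this.symm
      have hi0 : ∀ i : Fin n, F' i.succ 0 = A i.succ 0 * ↑a⁻¹ := by
        intro i
        have := hS i.succ 0
        simp [e2, e3, e4, e6, h00, ← ha] at this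
        rw [this]
        simp
      have h0j : ∀ j : Fin n, E' 0 j.succ = ↑a⁻¹ * A 0 j.succ := by
        intro j
        have := hS 0 j.succ
        simp [e1, e3, e4, e5, h00, ← ha] at this
        rw [this]
        simp
      obtain ⟨hF, hDD, hE⟩ := hU (Matrix.of fun i j => F' i.succ j.succ)
        (Matrix.of fun i j => D' i.succ j.succ) (Matrix.of fun i j => E' i.succ j.succ)
        ⟨fun i => hG'.lower_diag _, fun i j hij => hG'.lower_zero _ _ (by simpa using hij),
          fun i j hij => hG'.diag (by simpa [Fin.succ_inj] using hij),
          fun i => hG'.upper_diag _, fun i j hij => hG'.upper_zero _ _ (by simpa using hij), by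
            ext1 i j
            have := hS i.succ j.succ
            simp only [e3, e4, hi0, h0j, h00, mul_zero, zero_add, add_zero,
              Finset.sum_const_zero] at this
            simp only [S, Matrix.mul_apply, Matrix.of_apply]
            rw [this, ← ha]
            simp [mul_assoc]⟩
      refine ⟨?_, ?_, ?_⟩
      · ext1 i j
        cases i using Fin.cases with
        | zero => cases j using Fin.cases with
          | zero => simp [F₁, e5]
          | succ j => simp [F₁, e1]
        | succ i => cases j using Fin.cases with
          | zero => simp [F₁, hi0]
          | succ j => simpa [F₁] using congrFun (congrFun hF i) j
      · ext1 i j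
        cases i using Fin.cases with
        | zero => cases j using Fin.cases with
          | zero => simp [D₁, h00]
          | succ j => simp [D₁, e3]
        | succ i => cases j using Fin.cases with
          | zero => simp [D₁, e4]
          | succ j => simpa [D₁] using congrFun (congrFun hDD i) j
      · ext1 i j
        cases i using Fin.cases with
        | zero => cases j using Fin.cases with
          | zero => simp [E₁, e6]
          | succ j => simp [E₁, h0j]
        | succ i => cases j using Fin.cases with
          | zero => simp [E₁, e2]
          | succ j => simpa [E₁] using congrFun (congrFun hE i) j

end USeries

/-! ### The super Yangian in its RTT presentation -/

namespace SuperYangian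

section

variable {ι : Type*} [DecidableEq ι]

/-- The symbol `t_{i,j}^{(r)}` in the free algebra; `(i, j, r)` indexes the free generator
`t_{i,j}^{(r+1)}`, and `t_{i,j}^{(0)} = δ_{i,j}`. -/
def freeT (i j : ι) : ℕ → FreeAlgebra ℂ (ι × ι × ℕ)
  | 0 => if i = j then 1 else 0
  | r + 1 => FreeAlgebra.ι ℂ (i, j, r)

/-- The RTT relations. The left-hand side is the supercommutator
`[t_{i,j}^{(r)}, t_{k,l}^{(q)}]`, the parity of `t_{i,j}^{(r)}` being `|i| + |j|` modulo 2. -/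
inductive Rel (p : ι → Fin 2) :
    FreeAlgebra ℂ (ι × ι × ℕ) → FreeAlgebra ℂ (ι × ι × ℕ) → Prop
  | rtt (i j k l : ι) (r q : ℕ) (hr : 1 ≤ r) (hq : 1 ≤ q) :
      Rel p
        (freeT i j r * freeT k l q
          - (-1) ^ (((p i).val + (p j).val) * ((p k).val + (p l).val))
            * (freeT k l q * freeT i j r))
        ((-1) ^ ((p i).val * (p j).val + (p i).val * (p k).val + (p j).val * (p k).val)
          * ∑ a ∈ Finset.range (min r q),
              (freeT k j a * freeT i l (r + q - 1 - a) - freeT k j (r + q - 1 - a) * freeT i l a))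

end

end SuperYangian

/-- The algebra generated by `t_{i,j}^{(r)}`, `r ≥ 1`, subject to the RTT relations, for index
parities `p`. As the relations are homogeneous, this is the algebra underlying the
superalgebra with this presentation. -/
def SuperYangian {ι : Type*} [DecidableEq ι] (p : ι → Fin 2) : Type _ :=
  RingQuot (SuperYangian.Rel p)

namespace SuperYangian

instance {ι : Type*} [DecidableEq ι] (p : ι → Fin 2) : Ring (SuperYangian p) :=
  inferInstanceAs (Ring (RingQuot (SuperYangian.Rel p)))

instance {ι : Type*} [DecidableEq ι] (p : ι → Fin 2) : Algebra ℂ (SuperYangian p) :=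
  inferInstanceAs (Algebra ℂ (RingQuot (SuperYangian.Rel p)))

section

variable {ι : Type*} [DecidableEq ι] (p : ι → Fin 2)

/-- The quotient map from the free algebra. -/
def mkHom : FreeAlgebra ℂ (ι × ι × ℕ) →ₐ[ℂ] SuperYangian p :=
  RingQuot.mkAlgHom ℂ (Rel p)

/-- The element `t_{i,j}^{(r)}`; in particular `t_{i,j}^{(0)} = δ_{i,j}`. -/
def t (i j : ι) (r : ℕ) : SuperYangian p :=
  mkHom p (freeT i j r)

lemma t_zero (i j : ι) : t p i j 0 = if i = j then 1 else 0 := by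
  rw [t, freeT]
  split_ifs
  · exact map_one _
  · exact map_zero _

/-- The matrix `T(u)` with entries `t_{i,j}(u) = ∑_{r ≥ 0} t_{i,j}^{(r)} u^{-r}`. -/
def T : Matrix ι ι (SuperYangian p)⟦X⟧ :=
  Matrix.of fun i j => PowerSeries.mk fun r => t p i j r

lemma constantCoeff_T (i j : ι) : constantCoeff (T p i j) = if i = j then 1 else 0 := by
  rw [← PowerSeries.coeff_zero_eq_constantCoeff_apply]
  simp only [T, Matrix.of_apply, coeff_mk, t_zero]

lemma isUnit_T [Fintype ι] : IsUnit (T p) := USeries.isUnit_matrix (constantCoeff_T p)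

/-- The inverse matrix `T(u)⁻¹ = (t'_{i,j}(u))`, which exists by `isUnit_T`. -/
def T' [Fintype ι] : Matrix ι ι (SuperYangian p)⟦X⟧ := Ring.inverse (T p)

end

section

variable {n : ℕ} (p : Fin n → Fin 2)

lemma exists_gauss : ∃ D F E, IsGaussDecomposition (T p) F D E := by
  obtain ⟨F, D, E, h, -⟩ := USeries.gauss (T p) (constantCoeff_T p)
  exact ⟨D, F, E, h⟩

/-- The series `d_i(u)`: the diagonal entries of the diagonal factor in the Gauss decomposition
`T(u) = F(u) D(u) E(u)` (unique by `USeries.gauss`). -/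
def d (i : Fin n) : (SuperYangian p)⟦X⟧ := (exists_gauss p).choose i i

/-- `d_i(u)` is determined by any Gauss decomposition of `T(u)`. -/
lemma d_eq {F D E : Matrix (Fin n) (Fin n) (SuperYangian p)⟦X⟧}
    (h : IsGaussDecomposition (T p) F D E) (i : Fin n) : d p i = D i i := by
  obtain ⟨F₀, D₀, E₀, -, -, hU⟩ := USeries.gauss (T p) (constantCoeff_T p)
  obtain ⟨F', E', h'⟩ := (exists_gauss p).choose_spec
  rw [d, (hU _ _ _ h').2.1, (hU _ _ _ h).2.1]

lemma isUnit_d (i : Fin n) : IsUnit (d p i) := by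
  obtain ⟨F, D, E, h, hD, -⟩ := USeries.gauss (T p) (constantCoeff_T p)
  rw [d_eq p h]
  exact USeries.isUnit_of_constantCoeff_eq_one (hD i)

end

end SuperYangian

/-! ### 01-sequences, the series `b(u)` and the quantum Berezinian -/

/-- A `0^M 1^N`-sequence: `M` zeros and `N` ones arranged in a row. -/
structure ZeroOneSeq (M N : ℕ) where
  digit : Fin (M + N) → Fin 2
  card_zero : (Finset.univ.filter fun i => digit i = 0).card = M
  card_one : (Finset.univ.filter fun i => digit i = 1).card = N

namespace ZeroOneSeq

variable {M N : ℕ} (s : ZeroOneSeq M N)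

/-- The super Yangian `Y_{M|N}(s)`. -/
abbrev Y : Type := SuperYangian s.digit

/-- The positions `i_1 < ⋯ < i_M` of the zeros. -/
def zeroPos (k : Fin M) : Fin (M + N) :=
  (Finset.univ.filter fun i => s.digit i = 0).orderEmbOfFin s.card_zero k

/-- The positions `j_1 < ⋯ < j_N` of the ones. -/
def onePos (l : Fin N) : Fin (M + N) :=
  (Finset.univ.filter fun i => s.digit i = 1).orderEmbOfFin s.card_one l

/-- The integers `c_i` with `u_i = u + c_i`: the first one is the first digit, and passing from a
position to the next adds `-1` between two zeros, `1` between two ones and `0` between different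
digits. (Positions are counted from `0` here.) -/
def offset : (i : ℕ) → i < M + N → ℤ
  | 0, h => ((s.digit ⟨0, h⟩).val : ℤ)
  | i + 1, h =>
      offset i (Nat.lt_of_succ_lt h) +
        if s.digit ⟨i, Nat.lt_of_succ_lt h⟩ = 0 ∧ s.digit ⟨i + 1, h⟩ = 0 then -1
        else if s.digit ⟨i, Nat.lt_of_succ_lt h⟩ = 1 ∧ s.digit ⟨i + 1, h⟩ = 1 then 1
        else 0

/-- `d̃_i(u)`, which is `d_i(u)` if the `i`-th digit is `0` and `d_i(u)⁻¹` if it is `1`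
(the inverse exists by `SuperYangian.isUnit_d`). -/
def dTilde (i : Fin (M + N)) : s.Y⟦X⟧ :=
  if s.digit i = 0 then SuperYangian.d s.digit i else Ring.inverse (SuperYangian.d s.digit i)

/-- `b(u) = d̃_1(u_1) d̃_2(u_2) ⋯ d̃_{M+N}(u_{M+N})`, an ordered product. -/
def b : s.Y⟦X⟧ :=
  (List.ofFn fun i : Fin (M + N) => USeries.shift (s.offset i i.isLt : ℂ) (s.dTilde i)).prod

/-- The quantum Berezinian
`∑_ρ sgn(ρ) t_{i_ρ(1),i_1}(u) t_{i_ρ(2),i_2}(u-1) ⋯ t_{i_ρ(M),i_M}(u-M+1)`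
`× ∑_σ sgn(σ) t'_{j_1,j_σ(1)}(u-M+1) ⋯ t'_{j_N,j_σ(N)}(u-M+N)`. -/
def qsdet : s.Y⟦X⟧ :=
  (∑ ρ : Equiv.Perm (Fin M), (Equiv.Perm.sign ρ : ℤ) •
    (List.ofFn fun k : Fin M =>
      USeries.shift (-(k : ℂ)) (SuperYangian.T s.digit (s.zeroPos (ρ k)) (s.zeroPos k))).prod) *
  (∑ σ : Equiv.Perm (Fin N), (Equiv.Perm.sign σ : ℤ) •
    (List.ofFn fun l : Fin N =>
      USeries.shift (-(M : ℂ) + 1 + (l : ℂ))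
        (SuperYangian.T' s.digit (s.onePos l) (s.onePos (σ l)))).prod)

end ZeroOneSeq

end

noncomputable section

set_option linter.unusedSectionVars false

/-! The Gauss factors `d_i(u)` are the pivots of successive Schur complements of `T(u)`, so `b(u)`
is a shifted product of pivots `d_i^{±1}` eliminated in the natural order (`b_eq_pivotProd`). The
heart of the proof is that this product does not depend on the order of elimination
(`pivotProd_perm`). Centrality and the Berezinian formula both follow by choosing a convenient
order.

Schur complements are controlled through the inverse matrix: the inverse of a Schur complement of
`A` is a block of `A⁻¹`. The RTT relation for `A` is equivalent to a relation among entries of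
`A⁻¹`, which restricts to blocks, so every Schur complement again satisfies RTT. A third, mixed form
between `A(u)` and `A⁻¹(v)` makes entries with disjoint indices supercommute. Order independence
then reduces to two adjacent pivots: for equal parities their product is a symmetric quantum 2×2
minor, for opposite parities a short RTT computation suffices (`pivotPair_comm`).

For the Berezinian, all zeros are eliminated before all ones. Alternating sums with the Manin
exchange property are antisymmetric in their labels, so Laplace expansion identifies the even pivot
product with the first determinant (`altSum_even`). A Cramer argument identifies the odd one with
the determinant in the entries of `T⁻¹` (`altSum_odd`).

For centrality, the elements `t_{ii}^{(r)}` and `t_{ij}^{(1)}` generate. With `i` (or `i`, `j`)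
eliminated first, such a generator commutes with the first pivot (or with the product of the first
two), and also with all later pivots, because it supercommutes with the remaining Schur complement.
-/

namespace USeries

/-! ### Series in the two variables u⁻¹ and v⁻¹ -/

section twoVariable

variable {R : Type*} [Ring R]

/-- The series `v⁻¹ - u⁻¹`. -/
def varDiff (R : Type*) [Ring R] : R⟦X⟧⟦X⟧ := X - C X

/-- The series `u⁻¹ v⁻¹`. -/
def varMul (R : Type*) [Ring R] : R⟦X⟧⟦X⟧ := X * C X

lemma C_X_comm (f : R⟦X⟧⟦X⟧) : C X * f = f * C X := by
  ext1 n
  rw [coeff_C_mul, coeff_mul_C]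
  exact (PowerSeries.commute_X _).symm

lemma varDiff_comm (f : R⟦X⟧⟦X⟧) : varDiff R * f = f * varDiff R := by
  rw [varDiff, sub_mul, mul_sub, C_X_comm, (PowerSeries.commute_X f).eq]

lemma varMul_comm (f : R⟦X⟧⟦X⟧) : varMul R * f = f * varMul R := by
  rw [varMul, mul_assoc, C_X_comm, ← mul_assoc, ← (PowerSeries.commute_X f).eq, mul_assoc]

/-- A two-variable series is determined by its product with `v⁻¹ - u⁻¹ + e u⁻¹ v⁻¹`. -/
lemma eq_zero_of_varDiff_mul {f : R⟦X⟧⟦X⟧} (e : ℤ) (h : varDiff R * f = e • (varMul R * f)) :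
    f = 0 := by
  -- The coefficient of u^{-r} v^{-q-1} expresses row `r` through row `r - 1`, so vanishing
  -- propagates from row `0`.
  have key : ∀ r q, coeff r (coeff q f) = 0 := by
    intro r
    induction r with
    | zero =>
      intro q
      have := congrArg (fun x => coeff 0 (coeff (q + 1) x)) h
      simpa [-zsmul_eq_mul, map_zsmul, varDiff, varMul, sub_mul, mul_assoc, coeff_succ_X_mul, coeff_C_mul] using this
    | succ r ih =>
      intro q
      have := congrArg (fun x => coeff (r + 1) (coeff (q + 1) x)) h
      simpa [-zsmul_eq_mul, map_zsmul, varDiff, varMul, sub_mul, mul_assoc, coeff_succ_X_mul, coeff_C_mul, ih] using this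
  ext q r
  simpa using key r q

/-- The inner variable is u⁻¹ and the outer one v⁻¹: `C f` stands for f(u), `PowerSeries.map C g`
for g(v). -/
lemma coeff_coeff_C_mul_map_C (f g : R⟦X⟧) (r q : ℕ) :
    coeff r (coeff q (C f * PowerSeries.map C g)) = coeff r f * coeff q g := by
  rw [coeff_C_mul, PowerSeries.coeff_map, coeff_mul_C]

lemma coeff_coeff_map_C_mul_C (f g : R⟦X⟧) (r q : ℕ) :
    coeff r (coeff q (PowerSeries.map C g * C f)) = coeff q g * coeff r f := by
  rw [coeff_mul_C, PowerSeries.coeff_map, coeff_C_mul]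

lemma commute_of_forall_coeff {f g : R⟦X⟧} (h : ∀ r, Commute (C (coeff r f)) g) :
    Commute f g := by
  ext n
  rw [PowerSeries.coeff_mul, PowerSeries.coeff_mul, ← Finset.Nat.sum_antidiagonal_swap]
  refine Finset.sum_congr rfl fun x _ => ?_
  have := congrArg (coeff x.1) (h x.2).eq
  simpa using this

end twoVariable

/-! ### Evaluation at shifted arguments -/

section evaluation

variable {R : Type*} [Ring R] [Algebra ℂ R]

/-- A scalar power series, viewed as a central power series over `R`. -/
def scalar (w : ℂ⟦X⟧) : R⟦X⟧ := PowerSeries.map (algebraMap ℂ R) w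

lemma coeff_scalar_mul_C (w : ℂ⟦X⟧) (a : R) (n : ℕ) :
    coeff n (scalar w * C a) = coeff n w • a := by
  simp [scalar, Algebra.smul_def]

lemma scalar_comm (w : ℂ⟦X⟧) (f : R⟦X⟧) : scalar w * f = f * scalar w := by
  ext n
  rw [PowerSeries.coeff_mul, PowerSeries.coeff_mul, ← Finset.Nat.sum_antidiagonal_swap]
  refine Finset.sum_congr rfl fun x _ => ?_
  simpa [scalar] using Algebra.commutes _ _

lemma scalar_pow (w : ℂ⟦X⟧) (n : ℕ) : scalar (R := R) w ^ n = scalar (w ^ n) :=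
  (map_pow (PowerSeries.map (algebraMap ℂ R)) w n).symm

lemma scalar_mul (w w' : ℂ⟦X⟧) : scalar (R := R) (w * w') = scalar w * scalar w' :=
  map_mul (PowerSeries.map (algebraMap ℂ R)) w w'

lemma coeff_scalar_pow_mul_of_lt {w : ℂ⟦X⟧} (hw : constantCoeff w = 0) (f : R⟦X⟧) {n r : ℕ}
    (h : n < r) : coeff n (scalar w ^ r * f) = 0 := by
  obtain ⟨v, rfl⟩ := X_dvd_iff.mpr hw
  rw [scalar_pow, mul_pow, scalar_mul, mul_assoc]
  have : scalar (R := R) (X ^ r) = X ^ r := by simp [scalar]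
  rw [this, coeff_X_pow_mul', if_neg (by omega)]

/-- Evaluation of the outer variable of a power series over `R⟦X⟧` at a scalar power series. -/
def evalOuterFun (w : ℂ⟦X⟧) (h : R⟦X⟧⟦X⟧) : R⟦X⟧ :=
  PowerSeries.mk fun n => coeff n (∑ r ∈ Finset.range (n + 1), scalar w ^ r * coeff r h)

/-- The extra terms are divisible by too high a power of the variable. The free bound `N` lets all
coefficients in a convolution share one truncation. -/
lemma coeff_evalOuterFun {w : ℂ⟦X⟧} (hw : constantCoeff w = 0) (h : R⟦X⟧⟦X⟧) {n N : ℕ}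
    (hN : n < N) :
    coeff n (evalOuterFun w h) = coeff n (∑ r ∈ Finset.range N, scalar w ^ r * coeff r h) := by
  rw [evalOuterFun, coeff_mk, map_sum, map_sum]
  refine Finset.sum_subset (Finset.range_subset_range.mpr hN) fun r _ hr => ?_
  exact coeff_scalar_pow_mul_of_lt hw _ (by simpa using hr)

lemma evalOuterFun_mul {w : ℂ⟦X⟧} (hw : constantCoeff w = 0) (g h : R⟦X⟧⟦X⟧) :
    evalOuterFun w (g * h) = evalOuterFun w g * evalOuterFun w h := by
  ext n
  have h1 : coeff n (evalOuterFun w g * evalOuterFun w h) =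
      coeff n ((∑ r ∈ Finset.range (n + 1), scalar w ^ r * coeff r g) *
        ∑ r ∈ Finset.range (n + 1), scalar w ^ r * coeff r h) := by
    rw [PowerSeries.coeff_mul, PowerSeries.coeff_mul]
    refine Finset.sum_congr rfl fun x hx => ?_
    have := Finset.HasAntidiagonal.mem_antidiagonal.mp hx
    rw [coeff_evalOuterFun hw g (N := n + 1) (by omega),
      coeff_evalOuterFun hw h (N := n + 1) (by omega)]
  rw [h1, coeff_evalOuterFun hw _ (Nat.lt_succ_self n), Finset.sum_mul_sum, ← Finset.sum_product',
    map_sum, map_sum]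
  have h2 : ∀ x : ℕ × ℕ, scalar w ^ x.1 * coeff x.1 g * (scalar w ^ x.2 * coeff x.2 h) =
      scalar w ^ (x.1 + x.2) * (coeff x.1 g * coeff x.2 h) := by
    intro x
    rw [pow_add, mul_assoc, mul_assoc, ← mul_assoc (coeff x.1 g), scalar_pow w x.2,
      ← scalar_comm, mul_assoc]
  simp only [h2]
  -- The square of exponent pairs is cut along an antidiagonal. Pairs of sum at most `n` regroup
  -- into the coefficients of `g * h`; the others carry powers of `w` beyond `n`, invisible in
  -- degree `n`.
  rw [← Finset.sum_filter_add_sum_filter_not (Finset.range (n + 1) ×ˢ Finset.range (n + 1))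
    (fun x : ℕ × ℕ => x.1 + x.2 < n + 1)]
  rw [Finset.sum_eq_zero (s := Finset.filter (fun x : ℕ × ℕ => ¬ x.1 + x.2 < n + 1) _), add_zero]
  · rw [← Finset.sum_fiberwise_of_maps_to (g := fun x : ℕ × ℕ => x.1 + x.2)
      (t := Finset.range (n + 1))]
    · refine Finset.sum_congr rfl fun r hr => ?_
      rw [PowerSeries.coeff_mul (n := r), Finset.mul_sum, map_sum]
      have hr' := Finset.mem_range.mp hr
      have : Finset.filter (fun x : ℕ × ℕ => x.1 + x.2 = r)
          (Finset.filter (fun x : ℕ × ℕ => x.1 + x.2 < n + 1)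
            (Finset.range (n + 1) ×ˢ Finset.range (n + 1))) = Finset.HasAntidiagonal.antidiagonal r := by
        ext x
        simp only [Finset.mem_filter, Finset.mem_product, Finset.mem_range,
          Finset.HasAntidiagonal.mem_antidiagonal]
        omega
      rw [this]
      refine Finset.sum_congr rfl fun x hx => ?_
      rw [Finset.HasAntidiagonal.mem_antidiagonal.mp hx]
    · intro x hx
      simpa using (Finset.mem_filter.mp hx).2
  · intro x hx
    exact coeff_scalar_pow_mul_of_lt hw _ (by
      have := (Finset.mem_filter.mp hx).2
      omega)

/-- `evalOuterFun` as a ring homomorphism. -/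
def evalOuter (w : ℂ⟦X⟧) (hw : constantCoeff w = 0) : R⟦X⟧⟦X⟧ →+* R⟦X⟧ where
  toFun := evalOuterFun w
  map_one' := by
    ext n
    rw [evalOuterFun, coeff_mk, Finset.sum_eq_single 0]
    · simp
    · intro r _ hr
      simp [PowerSeries.coeff_one, hr]
    · simp
  map_zero' := by
    ext n
    simp [evalOuterFun]
  map_add' g h := by
    ext n
    simp [evalOuterFun, mul_add, Finset.sum_add_distrib]
  map_mul' := evalOuterFun_mul hw

lemma evalOuter_C {w : ℂ⟦X⟧} (hw : constantCoeff w = 0) (f : R⟦X⟧) :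
    evalOuter w hw (C f) = f := by
  ext n
  change coeff n (evalOuterFun w (C f)) = _
  rw [evalOuterFun, coeff_mk, Finset.sum_eq_single 0]
  · simp
  · intro r _ hr
    simp [PowerSeries.coeff_C, hr]
  · simp

lemma evalOuter_X {w : ℂ⟦X⟧} (hw : constantCoeff w = 0) :
    evalOuter w hw (X : R⟦X⟧⟦X⟧) = scalar w := by
  ext n
  change coeff n (evalOuterFun w X) = _
  rw [coeff_evalOuterFun hw _ (show n < n + 2 by omega), Finset.sum_eq_single 1]
  · simp
  · intro r _ hr
    simp [PowerSeries.coeff_X, hr]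
  · simp

lemma constantCoeff_shiftedVar (c : ℂ) : constantCoeff (shiftedVar c) = 0 := by
  simp [shiftedVar]

lemma shiftedVar_mul (c : ℂ) : shiftedVar c * (1 + C c * X) = X := by
  rw [shiftedVar, mul_assoc, PowerSeries.inv_mul_cancel, mul_one]
  simp

/-- This is 1/(u+c') - 1/(u+c) = (c-c')/((u+c)(u+c')). -/
lemma shiftedVar_sub (c c' : ℂ) :
    shiftedVar c' - shiftedVar c = C (c - c') * (shiftedVar c * shiftedVar c') := by
  have h := shiftedVar_mul c
  have h' := shiftedVar_mul c'
  have hu : ((1 + C c * X) * (1 + C c' * X) : ℂ⟦X⟧) ≠ 0 := by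
    intro hh
    have := congrArg constantCoeff hh
    simp at this
  apply mul_right_cancel₀ hu
  rw [map_sub]
  linear_combination (1 + C c * X) * h' - (1 + C c' * X) * h
    - (C c - C c') * (shiftedVar c' * (1 + C c' * X) * h + X * h')

lemma scalar_shiftedVar_mul_left_cancel (c : ℂ) {f g : R⟦X⟧}
    (h : scalar (shiftedVar c) * f = scalar (shiftedVar c) * g) : f = g := by
  have h2 : scalar (R := R) (1 + C c * X) * scalar (shiftedVar c) = X := by
    rw [← scalar_mul, mul_comm, shiftedVar_mul]
    simp [scalar]
  have h3 := congrArg (fun x => scalar (1 + C c * X) * x) h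
  simp only [← mul_assoc, h2] at h3
  ext n
  have := congrArg (coeff (n + 1)) h3
  simpa [coeff_succ_X_mul] using this

/-- The substitution `u ↦ u + c` as a ring homomorphism. -/
def shiftHom (c : ℂ) : R⟦X⟧ →+* R⟦X⟧ :=
  (evalOuter (shiftedVar c) (constantCoeff_shiftedVar c)).comp (PowerSeries.map C)

lemma shift_eq_shiftHom (c : ℂ) (f : R⟦X⟧) : shift c f = shiftHom c f := by
  ext n
  change _ = coeff n (evalOuterFun (shiftedVar c) (PowerSeries.map C f))
  rw [shift, coeff_mk, evalOuterFun, coeff_mk, map_sum]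
  refine Finset.sum_congr rfl fun r _ => ?_
  rw [PowerSeries.coeff_map, scalar_pow, coeff_scalar_mul_C]

lemma shiftHom_C (c : ℂ) (a : R) : shiftHom c (C a) = C a := by
  rw [shiftHom, RingHom.comp_apply, PowerSeries.map_C, evalOuter_C]

lemma shiftHom_X (c : ℂ) : shiftHom c (X : R⟦X⟧) = scalar (shiftedVar c) := by
  rw [shiftHom, RingHom.comp_apply, PowerSeries.map_X, evalOuter_X]

/-- Evaluation of a series in two variables `u⁻¹`, `v⁻¹` at `u + c` and `u + c'`. -/
def evalTwo (c c' : ℂ) : R⟦X⟧⟦X⟧ →+* R⟦X⟧ :=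
  (evalOuter (shiftedVar c') (constantCoeff_shiftedVar c')).comp (PowerSeries.map (shiftHom c))

lemma evalTwo_C (c c' : ℂ) (f : R⟦X⟧) : evalTwo c c' (C f) = shiftHom c f := by
  rw [evalTwo, RingHom.comp_apply, PowerSeries.map_C, evalOuter_C]

lemma evalTwo_map_C (c c' : ℂ) (f : R⟦X⟧) :
    evalTwo c c' (PowerSeries.map C f) = shiftHom c' f := by
  rw [evalTwo, RingHom.comp_apply, shiftHom.eq_1 c', RingHom.comp_apply]
  congr 1
  ext1 n
  simp [shiftHom_C]

lemma evalTwo_X (c c' : ℂ) : evalTwo c c' (X : R⟦X⟧⟦X⟧) = scalar (shiftedVar c') := by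
  rw [evalTwo, RingHom.comp_apply, PowerSeries.map_X, evalOuter_X]

/-- At (u+c, u+c') the factor v⁻¹ - u⁻¹ becomes `c - c'` times the value of u⁻¹v⁻¹, which cancels.
Relations with spectral parameters thus become relations with scalar coefficients. -/
lemma evalTwo_varDiff_mul {c c' : ℂ} {f g : R⟦X⟧⟦X⟧} (h : varDiff R * f = varMul R * g) :
    (c - c') • evalTwo c c' f = evalTwo c c' g := by
  have h1 := congrArg (evalTwo c c') h
  have h2 : evalTwo c c' (varDiff R) =
      scalar (shiftedVar c) * (scalar (shiftedVar c') * C (algebraMap ℂ R (c - c'))) := by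
    rw [varDiff, map_sub, evalTwo_X, evalTwo_C, shiftHom_X]
    have : scalar (R := R) (shiftedVar c') - scalar (shiftedVar c) =
      scalar (shiftedVar c' - shiftedVar c) := (map_sub (PowerSeries.map (algebraMap ℂ R)) _ _).symm
    rw [this, shiftedVar_sub, mul_comm, scalar_mul, scalar_mul, mul_assoc]
    simp [scalar]
  have h3 : evalTwo c c' (varMul R) = scalar (shiftedVar c) * scalar (shiftedVar c') := by
    rw [varMul, map_mul, evalTwo_X, evalTwo_C, shiftHom_X, scalar_comm]
  rw [map_mul, map_mul, h2, h3, mul_assoc, mul_assoc, mul_assoc] at h1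
  have h4 := scalar_shiftedVar_mul_left_cancel _ (scalar_shiftedVar_mul_left_cancel _ h1)
  rw [← h4]
  ext n
  rw [coeff_C_mul, PowerSeries.coeff_smul, Algebra.smul_def]

lemma commute_shiftHom {f g : R⟦X⟧} (h : ∀ r, Commute (C (coeff r f)) g) (c c' : ℂ) :
    Commute (shiftHom c f) (shiftHom c' g) := by
  refine commute_of_forall_coeff fun n => ?_
  rw [← shift_eq_shiftHom, shift, coeff_mk, map_sum]
  refine Commute.sum_left _ _ _ fun r _ => ?_
  have h1 : Commute (C (coeff r f)) (shiftHom c' g) := by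
    have := (h r).map (shiftHom c')
    rwa [shiftHom_C] at this
  rw [Algebra.smul_def, map_mul]
  refine Commute.mul_left ?_ h1
  have : C (algebraMap ℂ R (coeff n (shiftedVar c ^ r))) =
      scalar (R := R) (C (coeff n (shiftedVar c ^ r))) := by simp [scalar]
  rw [this]
  exact scalar_comm _ _

end evaluation

end USeries

namespace SuperYangian

/-- The sign `(-1)^{ab}` of a pair of parities. -/
def sgn (a b : Fin 2) : ℤ := (-1) ^ (a.val * b.val)

lemma sgn_mul_self (a b : Fin 2) : sgn a b * sgn a b = 1 := by
  rw [sgn, ← mul_pow]; simp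

lemma sgn_comm (a b : Fin 2) : sgn a b = sgn b a := by
  rw [sgn, sgn, mul_comm]

lemma sgn_zero_left (a : Fin 2) : sgn 0 a = 1 := by simp [sgn]

lemma sgn_zero_right (a : Fin 2) : sgn a 0 = 1 := by simp [sgn]

lemma sgn_one_one : sgn 1 1 = -1 := by simp [sgn]

/-! ### Equivalent forms of the RTT relation in an abstract ring -/

section abstractRelations

variable {W : Type*} [Ring W] {α β a b g h P : W}

/-- Here `a` is T₁(u), `b` is T₂(v), `g` and `h` are their inverses and `P` the super permutation.
`H` says (α - βP)ab = ba(α - βP); it is multiplied by `h` on both sides. -/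
lemma mixed_of_direct (hα : ∀ x, α * x = x * α) (hβ : ∀ x, β * x = x * β)
    (hb : b * h = 1) (hb' : h * b = 1)
    (H : α * (a * b - b * a) = β * (P * a * b - b * a * P)) :
    α * (h * a - a * h) = β * (h * P * a - a * P * h) := by
  have h1 : h * (a * b - b * a) * h = h * a - a * h := by
    calc _ = h * a * (b * h) - (h * b) * a * h := by noncomm_ring
      _ = _ := by rw [hb, hb']; noncomm_ring
  have h2 : h * (P * a * b - b * a * P) * h = h * P * a - a * P * h := by
    calc _ = h * P * a * (b * h) - (h * b) * a * P * h := by noncomm_ring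
      _ = _ := by rw [hb, hb']; noncomm_ring
  have := congrArg (fun x => h * x * h) H
  rwa [← mul_assoc, ← mul_assoc, ← hα, ← hβ, mul_assoc α, mul_assoc α, mul_assoc β, mul_assoc β,
    h1, h2] at this

lemma direct_of_mixed (hα : ∀ x, α * x = x * α) (hβ : ∀ x, β * x = x * β)
    (hb : b * h = 1) (hb' : h * b = 1)
    (H : α * (h * a - a * h) = β * (h * P * a - a * P * h)) :
    α * (a * b - b * a) = β * (P * a * b - b * a * P) := by
  have h1 : b * (h * a - a * h) * b = a * b - b * a := by
    calc _ = (b * h) * a * b - b * a * (h * b) := by noncomm_ring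
      _ = _ := by rw [hb, hb']; noncomm_ring
  have h2 : b * (h * P * a - a * P * h) * b = P * a * b - b * a * P := by
    calc _ = (b * h) * P * a * b - b * a * P * (h * b) := by noncomm_ring
      _ = _ := by rw [hb, hb']; noncomm_ring
  have := congrArg (fun x => b * x * b) H
  rwa [← mul_assoc, ← mul_assoc, ← hα, ← hβ, mul_assoc α, mul_assoc α, mul_assoc β, mul_assoc β,
    h1, h2] at this

/-- Multiplication by `g` on both sides yields gh(α - βP) = (α - βP)hg, a relation in the inverses
alone. -/
lemma inverse_of_mixed (hα : ∀ x, α * x = x * α) (hβ : ∀ x, β * x = x * β)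
    (ha : a * g = 1) (ha' : g * a = 1)
    (H : α * (h * a - a * h) = β * (h * P * a - a * P * h)) :
    α * (g * h - h * g) = β * (g * h * P - P * h * g) := by
  have h1 : g * (h * a - a * h) * g = g * h - h * g := by
    calc _ = g * h * (a * g) - (g * a) * h * g := by noncomm_ring
      _ = _ := by rw [ha, ha']; noncomm_ring
  have h2 : g * (h * P * a - a * P * h) * g = g * h * P - P * h * g := by
    calc _ = g * h * P * (a * g) - (g * a) * P * h * g := by noncomm_ring
      _ = _ := by rw [ha, ha']; noncomm_ring
  have := congrArg (fun x => g * x * g) H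
  rwa [← mul_assoc, ← mul_assoc, ← hα, ← hβ, mul_assoc α, mul_assoc α, mul_assoc β, mul_assoc β,
    h1, h2] at this

lemma mixed_of_inverse (hα : ∀ x, α * x = x * α) (hβ : ∀ x, β * x = x * β)
    (ha : a * g = 1) (ha' : g * a = 1)
    (H : α * (g * h - h * g) = β * (g * h * P - P * h * g)) :
    α * (h * a - a * h) = β * (h * P * a - a * P * h) := by
  have h1 : a * (g * h - h * g) * a = h * a - a * h := by
    calc _ = (a * g) * h * a - a * h * (g * a) := by noncomm_ring
      _ = _ := by rw [ha, ha']; noncomm_ring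
  have h2 : a * (g * h * P - P * h * g) * a = h * P * a - a * P * h := by
    calc _ = (a * g) * h * P * a - a * P * h * (g * a) := by noncomm_ring
      _ = _ := by rw [ha, ha']; noncomm_ring
  have := congrArg (fun x => a * x * a) H
  rwa [← mul_assoc, ← mul_assoc, ← hα, ← hβ, mul_assoc α, mul_assoc α, mul_assoc β, mul_assoc β,
    h1, h2] at this

end abstractRelations

/-! ### The super tensor square of a matrix algebra -/

section lifts

variable {κ : Type*} [Fintype κ] [DecidableEq κ] {S : Type*} [Ring S] (p : κ → Fin 2)

/-- A matrix acting on the first tensor factor, with the signs of the super tensor product. -/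
def liftFst (A : Matrix κ κ S) : Matrix (κ × κ) (κ × κ) S := Matrix.of fun x y =>
  if x.2 = y.2 then (sgn (p x.1) (p x.2) * sgn (p y.1) (p x.2)) • A x.1 y.1 else 0

/-- A matrix acting on the second tensor factor. -/
def liftSnd (B : Matrix κ κ S) : Matrix (κ × κ) (κ × κ) S := Matrix.of fun x y =>
  if x.1 = y.1 then B x.2 y.2 else 0

/-- The super permutation operator. -/
def superSwap (S : Type*) [Ring S] (p : κ → Fin 2) : Matrix (κ × κ) (κ × κ) S := Matrix.of fun x y =>
  if x = y.swap then (sgn (p x.1) (p x.2) : S) else 0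

lemma liftFst_mul (A B : Matrix κ κ S) :
    liftFst p A * liftFst p B = liftFst p (A * B) := by
  ext ⟨i, k⟩ ⟨j, l⟩
  simp only [Matrix.mul_apply, liftFst, Matrix.of_apply, Fintype.sum_prod_type]
  by_cases h : k = l
  · subst h
    simp only [if_true, Finset.smul_sum]
    refine Finset.sum_congr rfl fun m _ => ?_
    rw [Finset.sum_eq_single k (by intro n _ hn; simp [hn.symm]) (by simp)]
    simp only [if_true, smul_mul_smul_comm]
    congr 1
    linear_combination (sgn (p i) (p k) * sgn (p j) (p k)) * sgn_mul_self (p m) (p k)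
  · simp only [if_neg h]
    refine Finset.sum_eq_zero fun m _ => Finset.sum_eq_zero fun n _ => ?_
    by_cases hn : k = n
    · subst hn; simp [h]
    · simp [hn]

lemma liftFst_one : liftFst p (1 : Matrix κ κ S) = 1 := by
  ext ⟨i, k⟩ ⟨j, l⟩
  by_cases h : k = l <;> by_cases h' : i = j <;>
    simp_all [liftFst, sgn_mul_self, Matrix.one_apply, -mul_eq_one]

lemma liftSnd_mul (A B : Matrix κ κ S) : liftSnd A * liftSnd B = liftSnd (A * B) := by
  ext ⟨i, k⟩ ⟨j, l⟩
  simp only [Matrix.mul_apply, liftSnd, Matrix.of_apply, Fintype.sum_prod_type]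
  rw [Finset.sum_eq_single i (by intro n _ hn; simp [hn.symm]) (by simp)]
  by_cases h : i = j <;> simp [h]

lemma liftSnd_one : liftSnd (1 : Matrix κ κ S) = 1 := by
  ext ⟨i, k⟩ ⟨j, l⟩
  by_cases h : k = l <;> by_cases h' : i = j <;> simp_all [liftSnd, Matrix.one_apply]

lemma liftFst_mul_liftSnd_apply (A B : Matrix κ κ S) (i j k l : κ) :
    (liftFst p A * liftSnd B) (i, k) (j, l) =
      (sgn (p i) (p k) * sgn (p j) (p k)) • (A i j * B k l) := by
  simp only [Matrix.mul_apply, liftFst, liftSnd, Matrix.of_apply, Fintype.sum_prod_type]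
  rw [Finset.sum_eq_single j (by intro n _ hn; simp [hn]) (by simp),
    Finset.sum_eq_single k (by intro n _ hn; simp [hn.symm]) (by simp)]
  simp only [if_true, smul_mul_assoc]

lemma liftSnd_mul_liftFst_apply (A B : Matrix κ κ S) (i j k l : κ) :
    (liftSnd B * liftFst p A) (i, k) (j, l) =
      (sgn (p i) (p l) * sgn (p j) (p l)) • (B k l * A i j) := by
  simp only [Matrix.mul_apply, liftFst, liftSnd, Matrix.of_apply, Fintype.sum_prod_type]
  rw [Finset.sum_eq_single i (by intro n _ hn; simp [hn.symm]) (by simp),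
    Finset.sum_eq_single l (by intro n _ hn; simp [hn]) (by simp)]
  simp only [if_true, mul_smul_comm]

lemma superSwap_mul_apply (M : Matrix (κ × κ) (κ × κ) S) (i k : κ) (y : κ × κ) :
    (superSwap S p * M) (i, k) y = sgn (p i) (p k) • M (k, i) y := by
  rw [Matrix.mul_apply, Finset.sum_eq_single (k, i)]
  · simp [superSwap]
  · rintro ⟨m, n⟩ - h
    have : ¬ (i, k) = (m, n).swap := by
      rintro h'
      simp only [Prod.swap_prod_mk, Prod.mk.injEq] at h'
      exact h (by rw [h'.1, h'.2])
    simp only [superSwap, Matrix.of_apply, if_neg this, zero_mul]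
  · simp

lemma mul_superSwap_apply (M : Matrix (κ × κ) (κ × κ) S) (x : κ × κ) (j l : κ) :
    (M * superSwap S p) x (j, l) = sgn (p j) (p l) • M x (l, j) := by
  rw [Matrix.mul_apply, Finset.sum_eq_single (l, j)]
  · simp [superSwap, sgn_comm (p j), (Int.cast_commute _ _).eq]
  · rintro ⟨m, n⟩ - h
    have : ¬ (m, n) = (j, l).swap := h
    simp only [superSwap, Matrix.of_apply, if_neg this, mul_zero]
  · simp

/-- The super permutation exchanges the tensor factors; the signs of `liftFst` are exactly those
that make this true. -/
lemma liftSnd_mul_superSwap (B : Matrix κ κ S) :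
    liftSnd B * superSwap S p = superSwap S p * liftFst p B := by
  ext ⟨i, k⟩ ⟨j, l⟩
  rw [mul_superSwap_apply, superSwap_mul_apply]
  by_cases h : i = l
  · subst h
    simp only [liftSnd, liftFst, Matrix.of_apply, if_true, smul_smul]
    congr 1
    rw [sgn_comm (p k) (p i)]
    linear_combination -sgn (p j) (p i) * sgn_mul_self (p i) (p k)
  · simp [liftSnd, liftFst, h]

lemma superSwap_mul_liftSnd (B : Matrix κ κ S) :
    superSwap S p * liftSnd B = liftFst p B * superSwap S p := by
  ext ⟨i, k⟩ ⟨j, l⟩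
  rw [mul_superSwap_apply, superSwap_mul_apply]
  by_cases h : k = j
  · subst h
    simp only [liftSnd, liftFst, Matrix.of_apply, if_true, smul_smul]
    congr 1
    rw [sgn_comm (p k) (p l)]
    linear_combination -sgn (p i) (p k) * sgn_mul_self (p l) (p k)
  · simp [liftSnd, liftFst, h]

/-- H₂PA₁ = P(HA)₁, and a lift to the first factor is diagonal in the second index. This makes the
right side of the mixed relation vanish for disjoint indices. -/
lemma liftSnd_superSwap_liftFst_apply (A H : Matrix κ κ S) {i l : κ} (h : i ≠ l) (k j : κ) :
    (liftSnd H * superSwap S p * liftFst p A) (i, k) (j, l) = 0 := by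
  rw [liftSnd_mul_superSwap, mul_assoc, liftFst_mul, superSwap_mul_apply]
  simp [liftFst, h]

lemma liftFst_superSwap_liftSnd_apply (A H : Matrix κ κ S) {k j : κ} (h : k ≠ j) (i l : κ) :
    (liftFst p A * superSwap S p * liftSnd H) (i, k) (j, l) = 0 := by
  rw [mul_assoc, superSwap_mul_liftSnd, ← mul_assoc, liftFst_mul, mul_superSwap_apply]
  simp [liftFst, h]

/-- The RTT relation for a pair of matrices, entry by entry. -/
lemma direct_iff (α β : S) (A B : Matrix κ κ S) :
    (Matrix.diagonal fun _ => α) * (liftFst p A * liftSnd B - liftSnd B * liftFst p A) =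
      (Matrix.diagonal fun _ => β) *
        (superSwap S p * liftFst p A * liftSnd B - liftSnd B * liftFst p A * superSwap S p) ↔
    ∀ i j k l, α * ((sgn (p i) (p k) * sgn (p j) (p k)) • (A i j * B k l) -
        (sgn (p i) (p l) * sgn (p j) (p l)) • (B k l * A i j)) =
      β * (sgn (p i) (p j) • (A k j * B i l - B k j * A i l)) := by
  have key : ∀ i j k l, (superSwap S p * liftFst p A * liftSnd B -
      liftSnd B * liftFst p A * superSwap S p) (i, k) (j, l) =
      sgn (p i) (p j) • (A k j * B i l - B k j * A i l) := by
    intro i j k l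
    rw [Matrix.sub_apply, mul_assoc, superSwap_mul_apply, mul_superSwap_apply,
      liftFst_mul_liftSnd_apply, liftSnd_mul_liftFst_apply, smul_smul, smul_smul, smul_sub]
    congr 2
    · rw [sgn_comm (p k) (p i), sgn_comm (p j) (p i)]
      linear_combination sgn (p i) (p j) * sgn_mul_self (p i) (p k)
    · rw [sgn_comm (p l) (p j)]
      linear_combination sgn (p i) (p j) * sgn_mul_self (p j) (p l)
  constructor
  · intro h i j k l
    have := congrFun (congrFun h (i, k)) (j, l)
    rwa [Matrix.diagonal_mul, Matrix.diagonal_mul, key, Matrix.sub_apply,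
      liftFst_mul_liftSnd_apply, liftSnd_mul_liftFst_apply] at this
  · rintro h
    ext ⟨i, k⟩ ⟨j, l⟩
    rw [Matrix.diagonal_mul, Matrix.diagonal_mul, key, Matrix.sub_apply,
      liftFst_mul_liftSnd_apply, liftSnd_mul_liftFst_apply]
    exact h i j k l

/-- The relation satisfied by the inverses of a pair of RTT matrices, entry by entry. -/
lemma inverse_iff (α β : S) (G H : Matrix κ κ S) :
    (Matrix.diagonal fun _ => α) * (liftFst p G * liftSnd H - liftSnd H * liftFst p G) =
      (Matrix.diagonal fun _ => β) *
        (liftFst p G * liftSnd H * superSwap S p - superSwap S p * liftSnd H * liftFst p G) ↔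
    ∀ i j k l, α * ((sgn (p i) (p k) * sgn (p j) (p k)) • (G i j * H k l) -
        (sgn (p i) (p l) * sgn (p j) (p l)) • (H k l * G i j)) =
      β * ((sgn (p i) (p k) * sgn (p j) (p l) * sgn (p k) (p l)) •
        (G i l * H k j - H i l * G k j)) := by
  have key : ∀ i j k l, (liftFst p G * liftSnd H * superSwap S p -
      superSwap S p * liftSnd H * liftFst p G) (i, k) (j, l) =
      (sgn (p i) (p k) * sgn (p j) (p l) * sgn (p k) (p l)) • (G i l * H k j - H i l * G k j) := by
    intro i j k l
    rw [Matrix.sub_apply, mul_assoc (superSwap S p), superSwap_mul_apply, mul_superSwap_apply,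
      liftFst_mul_liftSnd_apply, liftSnd_mul_liftFst_apply, smul_smul, smul_smul, smul_sub]
    congr 2
    · rw [sgn_comm (p k) (p l)]
      ring
    · ring
  constructor
  · intro h i j k l
    have := congrFun (congrFun h (i, k)) (j, l)
    rwa [Matrix.diagonal_mul, Matrix.diagonal_mul, key, Matrix.sub_apply,
      liftFst_mul_liftSnd_apply, liftSnd_mul_liftFst_apply] at this
  · rintro h
    ext ⟨i, k⟩ ⟨j, l⟩
    rw [Matrix.diagonal_mul, Matrix.diagonal_mul, key, Matrix.sub_apply,
      liftFst_mul_liftSnd_apply, liftSnd_mul_liftFst_apply]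
    exact h i j k l

/-- In the mixed relation, entries with disjoint indices supercommute up to the factor `α`. -/
lemma mixed_apply {α β : S} {A H : Matrix κ κ S}
    (h : (Matrix.diagonal fun _ => α) * (liftSnd H * liftFst p A - liftFst p A * liftSnd H) =
      (Matrix.diagonal fun _ => β) *
        (liftSnd H * superSwap S p * liftFst p A - liftFst p A * superSwap S p * liftSnd H))
    {i j k l : κ} (hil : i ≠ l) (hkj : k ≠ j) :
    α * ((sgn (p i) (p l) * sgn (p j) (p l)) • (H k l * A i j) -
      (sgn (p i) (p k) * sgn (p j) (p k)) • (A i j * H k l)) = 0 := by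
  have := congrFun (congrFun h (i, k)) (j, l)
  rwa [Matrix.diagonal_mul, Matrix.diagonal_mul, Matrix.sub_apply, Matrix.sub_apply,
    liftFst_mul_liftSnd_apply, liftSnd_mul_liftFst_apply, liftSnd_superSwap_liftFst_apply _ _ _ hil,
    liftFst_superSwap_liftSnd_apply _ _ _ hkj, sub_zero, mul_zero] at this

lemma diagonal_comm {ι' : Type*} [Fintype ι'] [DecidableEq ι'] {α : S} (h : ∀ x, α * x = x * α)
    (M : Matrix ι' ι' S) :
    (Matrix.diagonal fun _ => α) * M = M * (Matrix.diagonal fun _ => α) := by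
  ext i j
  rw [Matrix.diagonal_mul, Matrix.mul_diagonal, h]

end lifts

/-! ### RTT relations for a block and its inverse -/

section relations

variable {ι : Type*} [DecidableEq ι] {R : Type*} [Ring R] (p : ι → Fin 2)

/-- The RTT relation between the entries of `A(u)` and `A(v)` with indices in `s`. -/
def IsRTT (s : Finset ι) (A : Matrix ι ι R⟦X⟧) : Prop :=
  ∀ i ∈ s, ∀ j ∈ s, ∀ k ∈ s, ∀ l ∈ s,
    USeries.varDiff R *
      ((sgn (p i) (p k) * sgn (p j) (p k)) • (C (A i j) * PowerSeries.map C (A k l)) -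
        (sgn (p i) (p l) * sgn (p j) (p l)) • (PowerSeries.map C (A k l) * C (A i j))) =
    USeries.varMul R *
      (sgn (p i) (p j) • (C (A k j) * PowerSeries.map C (A i l) -
        PowerSeries.map C (A k j) * C (A i l)))

/-- The relation between the entries of `G(u)` and `G(v)`, with indices in `s`, that holds for the
inverse of an RTT matrix. -/
def IsInverseRTT (s : Finset ι) (G : Matrix ι ι R⟦X⟧) : Prop :=
  ∀ i ∈ s, ∀ j ∈ s, ∀ k ∈ s, ∀ l ∈ s,
    USeries.varDiff R *
      ((sgn (p i) (p k) * sgn (p j) (p k)) • (C (G i j) * PowerSeries.map C (G k l)) -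
        (sgn (p i) (p l) * sgn (p j) (p l)) • (PowerSeries.map C (G k l) * C (G i j))) =
    USeries.varMul R *
      ((sgn (p i) (p k) * sgn (p j) (p l) * sgn (p k) (p l)) •
        (C (G i l) * PowerSeries.map C (G k j) - PowerSeries.map C (G i l) * C (G k j)))

/-- The blocks of `A` and `G` with indices in `s` are inverse to each other. -/
structure InvOn (s : Finset ι) (A G : Matrix ι ι R⟦X⟧) : Prop where
  mul : ∀ i ∈ s, ∀ j ∈ s, ∑ k ∈ s, A i k * G k j = if i = j then 1 else 0
  mul' : ∀ i ∈ s, ∀ j ∈ s, ∑ k ∈ s, G i k * A k j = if i = j then 1 else 0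

/-- Super commutation of a constant `τ` with the entries of `A`. The signs are given by `χ`. -/
def SuperCommOn (χ : ι → ℤ) (s : Finset ι) (τ : R) (A : Matrix ι ι R⟦X⟧) : Prop :=
  ∀ k ∈ s, ∀ l ∈ s, χ k • (C τ * A k l) = χ l • (A k l * C τ)

variable {p}

/-- Restriction matters because the inverse of a Schur complement is a restriction of the original
inverse. -/
lemma IsInverseRTT.mono {s t : Finset ι} (h : s ⊆ t) {G : Matrix ι ι R⟦X⟧}
    (hG : IsInverseRTT p t G) : IsInverseRTT p s G :=
  fun i hi j hj k hk l hl => hG i (h hi) j (h hj) k (h hk) l (h hl)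

lemma InvOn.matrix_mul {s : Finset ι} {A G : Matrix ι ι R⟦X⟧} (h : InvOn s A G)
    {S : Type*} [Ring S] (f : R⟦X⟧ →+* S) :
    (Matrix.of fun i j : s => f (A i j)) * (Matrix.of fun i j : s => f (G i j)) = 1 := by
  ext i j
  have := congrArg f (h.mul i i.2 j j.2)
  rw [map_sum, ← Finset.sum_coe_sort] at this
  simp only [map_mul] at this
  rw [Matrix.mul_apply, Matrix.one_apply]
  simp only [Matrix.of_apply, this, Subtype.ext_iff]
  split_ifs <;> simp

lemma InvOn.symm {s : Finset ι} {A G : Matrix ι ι R⟦X⟧} (h : InvOn s A G) : InvOn s G A :=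
  ⟨h.mul', h.mul⟩

/-- The common content of the three forms of the RTT relation for a matrix and its inverse. -/
def IsMixedRTT (p : ι → Fin 2) (s : Finset ι) (A G : Matrix ι ι R⟦X⟧) : Prop :=
  (Matrix.diagonal fun _ => USeries.varDiff R) *
      (liftSnd (Matrix.of fun i j : s => PowerSeries.map C (G i j)) *
          liftFst (fun i : s => p i) (Matrix.of fun i j : s => C (A i j)) -
        liftFst (fun i : s => p i) (Matrix.of fun i j : s => C (A i j)) *
          liftSnd (Matrix.of fun i j : s => PowerSeries.map C (G i j))) =
    (Matrix.diagonal fun _ => USeries.varMul R) *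
      (liftSnd (Matrix.of fun i j : s => PowerSeries.map C (G i j)) * superSwap R⟦X⟧⟦X⟧ (fun i : s => p i) *
          liftFst (fun i : s => p i) (Matrix.of fun i j : s => C (A i j)) -
        liftFst (fun i : s => p i) (Matrix.of fun i j : s => C (A i j)) *
          superSwap R⟦X⟧⟦X⟧ (fun i : s => p i) *
          liftSnd (Matrix.of fun i j : s => PowerSeries.map C (G i j)))

section

variable {s : Finset ι} {A G : Matrix ι ι R⟦X⟧} (h : InvOn s A G)

include h

lemma InvOn.liftFst_mul :
    liftFst (fun i : s => p i) (Matrix.of fun i j : s => (C (A i j) : R⟦X⟧⟦X⟧)) *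
      liftFst (fun i : s => p i) (Matrix.of fun i j : s => C (G i j)) = 1 := by
  rw [SuperYangian.liftFst_mul, h.matrix_mul, liftFst_one]

lemma InvOn.liftSnd_mul :
    liftSnd (Matrix.of fun i j : s => (PowerSeries.map C (A i j) : R⟦X⟧⟦X⟧)) *
      liftSnd (Matrix.of fun i j : s => PowerSeries.map C (G i j)) = 1 := by
  rw [SuperYangian.liftSnd_mul, h.matrix_mul, liftSnd_one]

lemma IsRTT.mixed (hA : IsRTT p s A) : IsMixedRTT p s A G :=
  mixed_of_direct (diagonal_comm USeries.varDiff_comm) (diagonal_comm USeries.varMul_comm)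
    h.liftSnd_mul h.symm.liftSnd_mul ((direct_iff (fun i : s => p i) _ _ _ _).mpr
      fun i j k l => hA i i.2 j j.2 k k.2 l l.2)

lemma IsInverseRTT.mixed (hG : IsInverseRTT p s G) : IsMixedRTT p s A G :=
  mixed_of_inverse (diagonal_comm USeries.varDiff_comm) (diagonal_comm USeries.varMul_comm)
    h.liftFst_mul h.symm.liftFst_mul ((inverse_iff (fun i : s => p i) _ _ _ _).mpr
      fun i j k l => hG i i.2 j j.2 k k.2 l l.2)

lemma IsMixedRTT.isRTT (hA : IsMixedRTT p s A G) : IsRTT p s A := fun i hi j hj k hk l hl =>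
  (direct_iff (fun i : s => p i) _ _ _ _).mp
    (direct_of_mixed (diagonal_comm USeries.varDiff_comm) (diagonal_comm USeries.varMul_comm)
      h.liftSnd_mul h.symm.liftSnd_mul hA) ⟨i, hi⟩ ⟨j, hj⟩ ⟨k, hk⟩ ⟨l, hl⟩

lemma IsMixedRTT.isInverseRTT (hA : IsMixedRTT p s A G) : IsInverseRTT p s G :=
  fun i hi j hj k hk l hl => (inverse_iff (fun i : s => p i) _ _ _ _).mp
    (inverse_of_mixed (diagonal_comm USeries.varDiff_comm) (diagonal_comm USeries.varMul_comm)
      h.liftFst_mul h.symm.liftFst_mul hA) ⟨i, hi⟩ ⟨j, hj⟩ ⟨k, hk⟩ ⟨l, hl⟩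

/-- Super commutation passes from a matrix to its inverse. -/
lemma SuperCommOn.of_inverse {χ : ι → ℤ} {τ : R} (hG : SuperCommOn χ s τ G) :
    SuperCommOn χ s τ A := by
  intro k hk l hl
  -- One double sum is contracted in two ways: over `n` as it stands, and (in `h2`) over `m` after
  -- `τ` has been moved past `G m n`.
  have h1 : ∑ m ∈ s, ∑ n ∈ s, A k m * (χ m • (C τ * G m n)) * A n l = χ l • (A k l * C τ) := by
    have : ∀ m ∈ s, ∑ n ∈ s, A k m * (χ m • (C τ * G m n)) * A n l =
        if m = l then χ l • (A k l * C τ) else 0 := by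
      intro m hm
      have : ∀ n ∈ s, A k m * (χ m • (C τ * G m n)) * A n l =
          χ m • (A k m * C τ * (G m n * A n l)) := by
        intro n _
        simp only [mul_smul_comm, smul_mul_assoc, mul_assoc]
      rw [Finset.sum_congr rfl this, ← Finset.smul_sum, ← Finset.mul_sum, h.mul' m hm l hl]
      split_ifs with hh
      · rw [hh, mul_one]
      · simp
    rw [Finset.sum_congr rfl this, Finset.sum_ite_eq' s l, if_pos hl]
  have h2 : ∑ n ∈ s, ∑ m ∈ s, A k m * (χ n • (G m n * C τ)) * A n l = χ k • (C τ * A k l) := by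
    have : ∀ n ∈ s, ∑ m ∈ s, A k m * (χ n • (G m n * C τ)) * A n l =
        if k = n then χ k • (C τ * A k l) else 0 := by
      intro n hn
      have : ∀ m ∈ s, A k m * (χ n • (G m n * C τ)) * A n l =
          χ n • (A k m * G m n * (C τ * A n l)) := by
        intro n _
        simp only [mul_smul_comm, smul_mul_assoc, mul_assoc]
      rw [Finset.sum_congr rfl this, ← Finset.smul_sum, ← Finset.sum_mul, h.mul k hk n hn]
      split_ifs with hh
      · rw [hh, one_mul]
      · simp
    rw [Finset.sum_congr rfl this, Finset.sum_ite_eq s k, if_pos hk]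
  rw [← h1, ← h2, Finset.sum_comm]
  refine Finset.sum_congr rfl fun m hm => Finset.sum_congr rfl fun n hn => ?_
  rw [hG m hm n hn]

end

/-- Entries of an RTT matrix and of its inverse with disjoint indices supercommute. -/
lemma IsMixedRTT.superCommOn {s t : Finset ι} {A G : Matrix ι ι R⟦X⟧}
    (hA : IsMixedRTT p s A G) {i j : ι} (hi : i ∈ s) (hj : j ∈ s) (hts : t ⊆ s) (hi' : i ∉ t)
    (hj' : j ∉ t) (r : ℕ) :
    SuperCommOn (fun k => sgn (p i) (p k) * sgn (p j) (p k)) t (coeff r (A i j)) G := by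
  intro k hk l hl
  have hil : (⟨i, hi⟩ : s) ≠ ⟨l, hts hl⟩ := fun h =>
    hi' ((Subtype.mk.inj h).symm ▸ hl)
  have hkj : (⟨k, hts hk⟩ : s) ≠ ⟨j, hj⟩ := fun h =>
    hj' (Subtype.mk.inj h ▸ hk)
  have := USeries.eq_zero_of_varDiff_mul 0
    ((mixed_apply (fun i : s => p i) hA hil hkj).trans (zero_smul ℤ _).symm)
  rw [sub_eq_zero] at this
  ext q
  have h2 := congrArg (fun x => coeff r (coeff q x)) this
  simp only [map_zsmul, Matrix.of_apply, USeries.coeff_coeff_C_mul_map_C,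
    USeries.coeff_coeff_map_C_mul_C] at h2
  simp only [map_zsmul, coeff_C_mul, coeff_mul_C]
  exact h2.symm

end relations

end SuperYangian

namespace SuperYangian

lemma map_ringInverse {S S' : Type*} [Ring S] [Ring S'] (f : S →+* S') {x : S} (hx : IsUnit x) :
    f (Ring.inverse x) = Ring.inverse (f x) := by
  obtain ⟨u, rfl⟩ := hx
  rw [Ring.inverse_unit]
  exact (Ring.inverse_unit (Units.map f.toMonoidHom u)).symm

/-! ### Schur complements and the order of elimination -/

section schur

variable {ι : Type*} {S : Type*} [Ring S]

/-- The Schur complement of the entry at `(a, a)`, as a matrix with all indices. -/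
def schur (a : ι) (A : Matrix ι ι S) : Matrix ι ι S := Matrix.of fun i j =>
  A i j - A i a * Ring.inverse (A a a) * A a j

lemma schur_apply (a : ι) (A : Matrix ι ι S) (i j : ι) :
    schur a A i j = A i j - A i a * Ring.inverse (A a a) * A a j := rfl

lemma schur_row_self {a : ι} {A : Matrix ι ι S} (h : IsUnit (A a a)) (j : ι) :
    schur a A a j = 0 := by
  rw [schur_apply, Ring.mul_inverse_cancel _ h, one_mul, sub_self]

lemma schur_col_self {a : ι} {A : Matrix ι ι S} (h : IsUnit (A a a)) (i : ι) :
    schur a A i a = 0 := by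
  rw [schur_apply, mul_assoc, Ring.inverse_mul_cancel _ h, mul_one, sub_self]

lemma schur_row_eq_zero {a i : ι} {A : Matrix ι ι S} (h : ∀ j, A i j = 0) (j : ι) :
    schur a A i j = 0 := by
  rw [schur_apply, h, h, zero_mul, zero_mul, sub_self]

lemma schur_col_eq_zero {a j : ι} {A : Matrix ι ι S} (h : ∀ i, A i j = 0) (i : ι) :
    schur a A i j = 0 := by
  rw [schur_apply, h, h, mul_zero, sub_self]

/-- The inverses of the two possible block eliminations of an invertible `2 × 2` matrix agree. -/
lemma inverse_two_by_two {a b c d x y z w : S} (hx : a * x = 1)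
    (hz : z * d = 1) (hy : (d - c * x * b) * y = 1) (hw : w * (a - b * z * c) = 1) :
    x * b * y = w * b * z ∧ y * c * x = z * c * w ∧ x + x * b * y * c * x = w ∧
      y = z + z * c * w * b * z := by
  -- A resolvent identity comparing the inverses `y` and `z` of d - cxb and `d`; the four claims all
  -- rest on it.
  have k1 : z * c * x * b * y = y - z := by
    have h := congrArg (fun t => z * t) hy
    have h2 : z * ((d - c * x * b) * y) = (z * d) * y - z * c * x * b * y := by noncomm_ring
    simp only [mul_one] at h
    rw [h2, hz, one_mul] at h
    exact (sub_sub_self y _).symm.trans (by rw [h])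
  have k2 : x * b * y = w * b * z := by
    have h : (a - b * z * c) * (x * b * y) = b * z := by
      calc _ = (a * x) * b * y - b * (z * c * x * b * y) := by noncomm_ring
        _ = _ := by rw [hx, k1]; noncomm_ring
    calc x * b * y = (w * (a - b * z * c)) * (x * b * y) := by rw [hw, one_mul]
      _ = w * ((a - b * z * c) * (x * b * y)) := by rw [mul_assoc]
      _ = _ := by rw [h, mul_assoc]
  have k3 : x + x * b * y * c * x = w := by
    have h : (a - b * z * c) * (x + x * b * y * c * x) = 1 := by
      calc _ = (a * x) + (a * x) * b * y * c * x - b * z * c * x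
            - b * (z * c * x * b * y) * c * x := by noncomm_ring
        _ = _ := by rw [hx, k1]; noncomm_ring
    calc _ = (w * (a - b * z * c)) * (x + x * b * y * c * x) := by rw [hw, one_mul]
      _ = w * ((a - b * z * c) * (x + x * b * y * c * x)) := by rw [mul_assoc]
      _ = w := by rw [h, mul_one]
  refine ⟨k2, ?_, k3, ?_⟩
  · rw [← k3]
    calc y * c * x = z * c * x + (y - z) * c * x := by noncomm_ring
      _ = z * c * x + (z * c * x * b * y) * c * x := by rw [k1]
      _ = _ := by noncomm_ring
  · calc y = z + (y - z) := by abel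
      _ = z + z * c * (x * b * y) := by rw [← k1]; noncomm_ring
      _ = _ := by rw [k2]; noncomm_ring

/-- Both sides are the Schur complement of the 2×2 block on `a`, `b`: once expanded, their
coefficients are the entries of the inverse of that block, computed by two eliminations. -/
lemma schur_comm {a b : ι} {A : Matrix ι ι S} (ha : IsUnit (A a a)) (hb : IsUnit (A b b))
    (hb' : IsUnit (schur a A b b)) (ha' : IsUnit (schur b A a a)) :
    schur b (schur a A) = schur a (schur b A) := by
  obtain ⟨h1, h2, h3, h4⟩ := inverse_two_by_two (c := A b a)
    (y := Ring.inverse (schur a A b b)) (w := Ring.inverse (schur b A a a)) (Ring.mul_inverse_cancel _ ha)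
    (Ring.inverse_mul_cancel _ hb)
    (Ring.mul_inverse_cancel _ hb') (Ring.inverse_mul_cancel _ ha')
  ext k l
  rw [schur_apply b, schur_apply a (schur b A)]
  generalize Ring.inverse (schur a A b b) = y at *
  generalize Ring.inverse (schur b A a a) = w at *
  simp only [schur_apply]
  generalize Ring.inverse (A a a) = x at *
  generalize Ring.inverse (A b b) = z at *
  have e1 : A k l - A k a * x * A a l - (A k b - A k a * x * A a b) * y *
      (A b l - A b a * x * A a l) = A k l - A k b * y * A b l
        - A k a * (x + x * A a b * y * A b a * x) * A a l
        + A k a * (x * A a b * y) * A b l + A k b * (y * A b a * x) * A a l := by noncomm_ring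
  have e2 : A k l - A k b * z * A b l - (A k a - A k b * z * A b a) * w *
      (A a l - A a b * z * A b l) = A k l - A k b * (z + z * A b a * w * A a b * z) * A b l
        - A k a * w * A a l
        + A k a * (w * A a b * z) * A b l + A k b * (z * A b a * w) * A a l := by noncomm_ring
  rw [e1, e2, h3, h1, h2, ← h4]

end schur

/-! ### Elimination inside matrices satisfying RTT -/

section good

variable {ι : Type*} [DecidableEq ι] {R : Type*} [Ring R] {p : ι → Fin 2}
  {s : Finset ι} {A G : Matrix ι ι R⟦X⟧}

/-- Elimination changes `A` but leaves `G` untouched: a Schur complement is inverse to the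
corresponding block of the full inverse. -/
lemma InvOn.schur (h : InvOn s A G) {a : ι} (ha : a ∈ s) (hu : IsUnit (A a a)) :
    InvOn (s.erase a) (schur a A) G := by
  constructor
  · intro i hi j hj
    obtain ⟨hia, his⟩ := Finset.mem_erase.mp hi
    obtain ⟨hja, hjs⟩ := Finset.mem_erase.mp hj
    have h1 := h.mul i his j hjs
    have h2 := h.mul a ha j hjs
    rw [← Finset.add_sum_erase _ _ ha] at h1 h2
    rw [if_neg hja.symm] at h2
    rw [← h1]
    simp only [schur_apply, sub_mul, Finset.sum_sub_distrib, mul_assoc]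
    rw [← Finset.mul_sum, ← Finset.mul_sum, eq_neg_of_add_eq_zero_right h2, mul_neg,
      ← mul_assoc (Ring.inverse _), Ring.inverse_mul_cancel _ hu, one_mul, mul_neg]
    abel
  · intro i hi j hj
    obtain ⟨hia, his⟩ := Finset.mem_erase.mp hi
    obtain ⟨hja, hjs⟩ := Finset.mem_erase.mp hj
    have h1 := h.mul' i his j hjs
    have h2 := h.mul' i his a ha
    rw [← Finset.add_sum_erase _ _ ha] at h1 h2
    rw [if_neg hia] at h2
    rw [← h1]
    simp only [schur_apply, mul_sub, Finset.sum_sub_distrib, ← mul_assoc]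
    rw [← Finset.sum_mul, ← Finset.sum_mul, eq_neg_of_add_eq_zero_right h2, neg_mul,
      mul_assoc (G i a), Ring.mul_inverse_cancel _ hu, mul_one, neg_mul]
    abel

/-- A matrix of series congruent to the identity on `s`, inverse there to a matrix `G` that
satisfies the inverse RTT relation. -/
structure IsYangianBlock (p : ι → Fin 2) (s : Finset ι) (A G : Matrix ι ι R⟦X⟧) : Prop where
  invOn : InvOn s A G
  constantCoeff : ∀ i ∈ s, ∀ j ∈ s, PowerSeries.constantCoeff (A i j) = if i = j then 1 else 0
  isInverseRTT : IsInverseRTT p s G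

namespace IsYangianBlock

variable (h : IsYangianBlock p s A G)

include h

lemma isUnit {a : ι} (ha : a ∈ s) : IsUnit (A a a) :=
  USeries.isUnit_of_constantCoeff_eq_one (by simpa using h.constantCoeff a ha a ha)

/-- The relation is imposed on `G`, so it is inherited by mere restriction; RTT for the Schur
complement then comes from inverting (`isRTT`). -/
lemma schur {a : ι} (ha : a ∈ s) : IsYangianBlock p (s.erase a) (schur a A) G where
  invOn := h.invOn.schur ha (h.isUnit ha)
  constantCoeff i hi j hj := by
    obtain ⟨hia, his⟩ := Finset.mem_erase.mp hi
    obtain ⟨hja, hjs⟩ := Finset.mem_erase.mp hj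
    rw [schur_apply, map_sub, map_mul, h.constantCoeff a ha j hjs, if_neg hja.symm,
      mul_zero, sub_zero, h.constantCoeff i his j hjs]
  isInverseRTT := h.isInverseRTT.mono (Finset.erase_subset _ _)

lemma isMixedRTT : IsMixedRTT p s A G := h.isInverseRTT.mixed h.invOn

lemma isRTT : IsRTT p s A := h.isMixedRTT.isRTT h.invOn

/-- `A a a` supercommutes with the entries of `G` away from `a`, hence with the inverse of that
block, which is the Schur complement. The signs are trivial because `A a a` is even. -/
lemma commute_schur {a : ι} (ha : a ∈ s) {k l : ι} (hk : k ∈ s.erase a) (hl : l ∈ s.erase a)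
    (r : ℕ) : Commute (C (coeff r (A a a))) (SuperYangian.schur a A k l) := by
  have h1 := (h.isMixedRTT.superCommOn ha ha (Finset.erase_subset a s) (by simp) (by simp)
    r).of_inverse (h.schur ha).invOn k hk l hl
  simp only [sgn_mul_self, one_smul] at h1
  exact h1

end IsYangianBlock

/-- Passing `A k a`, the inverse pivot and `A a l` costs the signs χ_k χ_a, 1 and χ_a χ_l; the two
χ_a cancel. -/
lemma SuperCommOn.schur {χ : ι → ℤ} {τ : R} (hτ : SuperCommOn χ s τ A)
    (hχ : ∀ k, χ k * χ k = 1) {a : ι} (ha : a ∈ s) (hu : IsUnit (A a a)) :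
    SuperCommOn χ (s.erase a) τ (schur a A) := by
  intro k hk l hl
  have hk := Finset.mem_of_mem_erase hk
  have hl := Finset.mem_of_mem_erase hl
  have h0 : C τ * Ring.inverse (A a a) = Ring.inverse (A a a) * C τ := by
    have h1 := congrArg (fun x => χ a • (Ring.inverse (A a a) * x * Ring.inverse (A a a)))
      (hτ a ha a ha)
    simp only [mul_smul_comm, smul_mul_assoc, smul_smul, hχ, one_smul] at h1
    rw [← mul_assoc, ← mul_assoc, mul_assoc _ (A a a), Ring.mul_inverse_cancel _ hu, mul_one,
      Ring.inverse_mul_cancel _ hu, one_mul] at h1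
    exact h1.symm
  rw [schur_apply, mul_sub, sub_mul, smul_sub, smul_sub, hτ k hk l hl]
  congr 1
  calc χ k • (C τ * (A k a * Ring.inverse (A a a) * A a l))
      = χ k • (C τ * A k a) * Ring.inverse (A a a) * A a l := by
        simp only [smul_mul_assoc, mul_assoc]
    _ = A k a * (C τ * Ring.inverse (A a a)) * (χ a • A a l) := by
        rw [hτ k hk a ha, h0]
        simp only [smul_mul_assoc, mul_smul_comm, mul_assoc, h0]
    _ = A k a * Ring.inverse (A a a) * (χ a • (C τ * A a l)) := by
        rw [h0]
        simp only [mul_smul_comm, mul_assoc]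
    _ = _ := by
        rw [hτ a ha l hl]
        simp only [mul_smul_comm, mul_assoc]

end good

/-! ### RTT at arguments one step apart, and quantum 2×2 minors -/

section specialization

variable {ι : Type*} [DecidableEq ι] {R : Type*} [Ring R] [Algebra ℂ R] {p : ι → Fin 2}
  {s : Finset ι} {A G : Matrix ι ι R⟦X⟧}

open USeries

/-- The RTT relation between `A(u + c)` and `A(u + c')`. -/
lemma IsRTT.shift (h : IsRTT p s A) (c c' : ℂ) {i j k l : ι} (hi : i ∈ s) (hj : j ∈ s) (hk : k ∈ s)
    (hl : l ∈ s) :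
    (c - c') • ((sgn (p i) (p k) * sgn (p j) (p k)) • (shiftHom c (A i j) * shiftHom c' (A k l)) -
        (sgn (p i) (p l) * sgn (p j) (p l)) • (shiftHom c' (A k l) * shiftHom c (A i j))) =
      sgn (p i) (p j) • (shiftHom c (A k j) * shiftHom c' (A i l) -
        shiftHom c' (A k j) * shiftHom c (A i l)) := by
  have := evalTwo_varDiff_mul (c := c) (c' := c') (h i hi j hj k hk l hl)
  simpa only [map_sub, map_zsmul, map_mul, evalTwo_C, evalTwo_map_C] using this

lemma IsInverseRTT.shift (h : IsInverseRTT p s G) (c c' : ℂ) {i j k l : ι} (hi : i ∈ s)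
    (hj : j ∈ s) (hk : k ∈ s) (hl : l ∈ s) :
    (c - c') • ((sgn (p i) (p k) * sgn (p j) (p k)) • (shiftHom c (G i j) * shiftHom c' (G k l)) -
        (sgn (p i) (p l) * sgn (p j) (p l)) • (shiftHom c' (G k l) * shiftHom c (G i j))) =
      (sgn (p i) (p k) * sgn (p j) (p l) * sgn (p k) (p l)) •
        (shiftHom c (G i l) * shiftHom c' (G k j) - shiftHom c' (G i l) * shiftHom c (G k j)) := by
  have := evalTwo_varDiff_mul (c := c) (c' := c') (h i hi j hj k hk l hl)
  simpa only [map_sub, map_zsmul, map_mul, evalTwo_C, evalTwo_map_C] using this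

/-- The step `1` or `-1` by which the argument decreases after an index of the given parity. -/
def step (e : Fin 2) : ℂ := if e = 0 then 1 else -1

lemma sgn_self_eq_step (e : Fin 2) : (sgn e e : ℂ) = step e := by
  fin_cases e <;> simp [sgn, step]

lemma step_mul_self (e : Fin 2) : step e * step e = 1 := by
  fin_cases e <;> simp [step]

/-- The RTT relation for indices of equal parity, at arguments that differ by one step. -/
lemma IsRTT.shift_step (h : IsRTT p s A) {e : Fin 2} {c c' : ℂ} (hc : c - c' = step e)
    {i j k l : ι} (hi : i ∈ s) (hj : j ∈ s) (hk : k ∈ s) (hl : l ∈ s) (hpi : p i = e)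
    (hpj : p j = e) (hpk : p k = e) (hpl : p l = e) :
    shiftHom c (A i j) * shiftHom c' (A k l) - shiftHom c' (A k l) * shiftHom c (A i j) =
      shiftHom c (A k j) * shiftHom c' (A i l) - shiftHom c' (A k j) * shiftHom c (A i l) := by
  have := h.shift c c' hi hj hk hl
  rw [hpi, hpj, hpk, hpl, sgn_mul_self, one_smul, one_smul, ← Int.cast_smul_eq_zsmul ℂ,
    sgn_self_eq_step, hc] at this
  have h2 := congrArg (fun x => step e • x) this
  simpa only [smul_smul, step_mul_self, one_smul] using h2

lemma IsInverseRTT.shift_step (h : IsInverseRTT p s G) {e : Fin 2} {c c' : ℂ}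
    (hc : c - c' = step e)
    {i j k l : ι} (hi : i ∈ s) (hj : j ∈ s) (hk : k ∈ s) (hl : l ∈ s) (hpi : p i = e)
    (hpj : p j = e) (hpk : p k = e) (hpl : p l = e) :
    shiftHom c (G i j) * shiftHom c' (G k l) - shiftHom c' (G k l) * shiftHom c (G i j) =
      shiftHom c (G i l) * shiftHom c' (G k j) - shiftHom c' (G i l) * shiftHom c (G k j) := by
  have := h.shift c c' hi hj hk hl
  rw [hpi, hpj, hpk, hpl, sgn_mul_self, one_smul, one_smul, one_mul, ← Int.cast_smul_eq_zsmul ℂ,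
    sgn_self_eq_step, hc] at this
  have h2 := congrArg (fun x => step e • x) this
  simpa only [smul_smul, step_mul_self, one_smul] using h2

lemma shiftHom_schur (c : ℂ) {a : ι} (hu : IsUnit (A a a)) (i j : ι) :
    shiftHom c (schur a A i j) = shiftHom c (A i j) -
      shiftHom c (A i a) * Ring.inverse (shiftHom c (A a a)) * shiftHom c (A a j) := by
  rw [schur_apply, map_sub, map_mul, map_mul, map_ringInverse _ hu]

namespace IsYangianBlock

variable (h : IsYangianBlock p s A G)

include h

lemma isUnit_schur {a b : ι} (ha : a ∈ s) (hb : b ∈ s) (hab : a ≠ b) :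
    IsUnit (SuperYangian.schur a A b b) :=
  (h.schur ha).isUnit (Finset.mem_erase.mpr ⟨hab.symm, hb⟩)

lemma commute_shift_schur {a b : ι} (ha : a ∈ s) (hb : b ∈ s) (hab : a ≠ b) (c c' : ℂ) :
    Commute (shiftHom c (A a a)) (shiftHom c' (SuperYangian.schur a A b b)) :=
  commute_shiftHom (h.commute_schur ha (Finset.mem_erase.mpr ⟨hab.symm, hb⟩)
    (Finset.mem_erase.mpr ⟨hab.symm, hb⟩)) c c'

/-- For equal parities, the product of the first two pivots is a quantum minor. -/
lemma pivot_mul_same {a b : ι} (ha : a ∈ s) (hb : b ∈ s) (hp : p a = p b) {c c' : ℂ}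
    (hc : c - c' = step (p b)) :
    shiftHom c (A a a) * shiftHom c' (SuperYangian.schur a A b b) =
      shiftHom c (A a a) * shiftHom c' (A b b) - shiftHom c (A b a) * shiftHom c' (A a b) := by
  have h1 := h.isRTT.shift_step hc ha ha hb ha hp hp rfl hp
  -- The arguments trade places, which puts `A a a` at `c'` next to its inverse in the Schur
  -- complement.
  have h2 : shiftHom c (A a a) * shiftHom c' (A b a) =
      shiftHom c (A b a) * shiftHom c' (A a a) := by
    have h3 := sub_eq_sub_iff_sub_eq_sub.mp h1
    simp only [sub_self] at h3
    exact sub_eq_zero.mp h3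
  rw [shiftHom_schur _ (h.isUnit ha), mul_sub, ← mul_assoc, ← mul_assoc, h2,
    mul_assoc _ (shiftHom c' (A a a)), Ring.mul_inverse_cancel _ ((h.isUnit ha).map _), mul_one]

/-- Both products are quantum minors, and the sum of two RTT relations shows the minor to be
symmetric in `a` and `b`. -/
lemma pivot_mul_same_symm {a b : ι} (ha : a ∈ s) (hb : b ∈ s) (hp : p a = p b) {c c' : ℂ}
    (hc : c - c' = step (p b)) :
    shiftHom c (A a a) * shiftHom c' (SuperYangian.schur a A b b) =
      shiftHom c (A b b) * shiftHom c' (SuperYangian.schur b A a a) := by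
  rw [h.pivot_mul_same ha hb hp hc, h.pivot_mul_same hb ha hp.symm (by rwa [hp])]
  have h1 := h.isRTT.shift_step hc ha ha hb hb hp hp rfl rfl
  have h2 := h.isRTT.shift_step hc ha hb hb ha hp rfl rfl hp
  linear_combination (norm := abel) h1 + h2

end IsYangianBlock

end specialization

end SuperYangian

namespace SuperYangian

/-! ### The pivot product is independent of the order of elimination -/

section berezinian

variable {ι : Type*} [DecidableEq ι] {R : Type*} [Ring R] [Algebra ℂ R] {p : ι → Fin 2}
  {s : Finset ι} {A G : Matrix ι ι R⟦X⟧}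

open USeries

/-- `x` or its inverse, according to the parity. -/
def signedInv {S : Type*} [Ring S] (e : Fin 2) (x : S) : S := if e = 0 then x else Ring.inverse x

lemma signedInv_zero {S : Type*} [Ring S] (x : S) : signedInv 0 x = x := if_pos rfl

lemma signedInv_one {S : Type*} [Ring S] (x : S) : signedInv 1 x = Ring.inverse x :=
  if_neg one_ne_zero

/-- The shifted product of the successive pivots `d_a(u)^{±1}` of `A`, eliminated in the order of
the list. -/
def pivotProd (p : ι → Fin 2) : List ι → Matrix ι ι R⟦X⟧ → ℂ → R⟦X⟧
  | [], _, _ => 1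
  | a :: l, A, c => shiftHom (c + (p a).val) (signedInv (p a) (A a a)) *
      pivotProd p l (schur a A) (c - step (p a))

lemma ringInverse_mul_of_isUnit {S : Type*} [Ring S] {x y : S} (hx : IsUnit x) (hy : IsUnit y) :
    Ring.inverse (x * y) = Ring.inverse y * Ring.inverse x := by
  obtain ⟨u, rfl⟩ := hx
  obtain ⟨v, rfl⟩ := hy
  rw [← Units.val_mul, Ring.inverse_unit, Ring.inverse_unit, Ring.inverse_unit, mul_inv_rev,
    Units.val_mul]

lemma parity_cases (e : Fin 2) : e = 0 ∨ e = 1 := by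
  fin_cases e <;> simp

lemma eq_of_two_smul {M : Type*} [AddCommGroup M] [Module ℂ M] {x y : M}
    (h : (2 : ℂ) • x = (2 : ℂ) • y) : x = y := by
  have := congrArg (fun t => (2⁻¹ : ℂ) • t) h
  simpa [smul_smul] using this

namespace IsYangianBlock

variable (h : IsYangianBlock p s A G)

include h

/-- Comparison of the pivots in the two orders, for an even and an odd index. -/
lemma pivot_mul_mixed {a b : ι} (ha : a ∈ s) (hb : b ∈ s) (hpa : p a = 0) (hpb : p b = 1)
    {c c' : ℂ} (hc : c' - c = 1) :
    shiftHom c' (A b b) * shiftHom c (A a a) =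
      shiftHom c' (SuperYangian.schur b A a a) * shiftHom c (SuperYangian.schur a A b b) := by
  have rel : ∀ i ∈ s, ∀ j ∈ s, ∀ k ∈ s, ∀ l ∈ s,
      (sgn (p i) (p k) * sgn (p j) (p k)) • (shiftHom c' (A i j) * shiftHom c (A k l)) -
        (sgn (p i) (p l) * sgn (p j) (p l)) • (shiftHom c (A k l) * shiftHom c' (A i j)) =
      sgn (p i) (p j) • (shiftHom c' (A k j) * shiftHom c (A i l) -
        shiftHom c (A k j) * shiftHom c' (A i l)) := by
    intro i hi j hj k hk l hl
    have := h.isRTT.shift c' c hi hj hk hl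
    rwa [hc, one_smul] at this
  have hab : a ≠ b := by rintro rfl; simp [hpa] at hpb
  have r1 := rel b hb a ha b hb a ha
  have r2 := rel b hb a ha b hb b hb
  have r3 := rel b hb b hb b hb a ha
  have r4 := rel a ha a ha b hb a ha
  have r5 := rel b hb b hb a ha a ha
  have r6 := rel b hb a ha a ha b hb
  simp only [hpa, hpb, sgn_zero_left, sgn_zero_right, sgn_one_one, one_smul, neg_smul, mul_one,
    neg_neg, mul_neg] at r1 r2 r3 r4 r5 r6
  have ua : IsUnit (shiftHom c (A a a)) := (h.isUnit ha).map _
  have ub : IsUnit (shiftHom c' (A b b)) := (h.isUnit hb).map _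
  rw [shiftHom_schur _ (h.isUnit ha), shiftHom_schur _ (h.isUnit hb)]
  -- An odd entry squares to zero in this shifted sense, which removes the last term of the
  -- expansion `e1`.
  have k1 : shiftHom c' (A b a) * shiftHom c (A b a) = 0 := by
    apply eq_of_two_smul (y := 0)
    rw [smul_zero, two_smul]
    linear_combination (norm := abel) -r1
  have k2 : shiftHom c' (A b a) * shiftHom c (A b b) =
      shiftHom c' (A b b) * shiftHom c (A b a) := by
    apply eq_of_two_smul
    rw [two_smul, two_smul]
    linear_combination (norm := abel) -r2 - r3
  have k3 : shiftHom c' (A a a) * shiftHom c (A b a) =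
      shiftHom c' (A b a) * shiftHom c (A a a) := by
    linear_combination (norm := abel) r4
  generalize shiftHom c (A a a) = a₀ at *
  generalize shiftHom c (A a b) = b₀ at *
  generalize shiftHom c (A b a) = c₀ at *
  generalize shiftHom c (A b b) = d₀ at *
  generalize shiftHom c' (A a a) = a₁ at *
  generalize shiftHom c' (A a b) = b₁ at *
  generalize shiftHom c' (A b a) = c₁ at *
  generalize shiftHom c' (A b b) = d₁ at *
  have e1 : (a₁ - b₁ * Ring.inverse d₁ * c₁) * (d₀ - c₀ * Ring.inverse a₀ * b₀) =
      a₁ * d₀ - b₁ * Ring.inverse d₁ * (c₁ * d₀) - (a₁ * c₀) * Ring.inverse a₀ * b₀ +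
      b₁ * Ring.inverse d₁ * (c₁ * c₀) * Ring.inverse a₀ * b₀ := by noncomm_ring
  rw [e1, k1, k2, k3, ← mul_assoc, mul_assoc b₁, Ring.inverse_mul_cancel _ ub, mul_assoc c₁,
    Ring.mul_inverse_cancel _ ua]
  simp only [mul_one, mul_zero, zero_mul, add_zero]
  -- What remains is d₁a₀ = a₁d₀ - b₁c₀ - c₁b₀.
  linear_combination (norm := abel) r5 + r6

/-- The product of the first two pivots does not depend on their order. -/
lemma pivotPair_comm {a b : ι} (ha : a ∈ s) (hb : b ∈ s) (hab : a ≠ b) (c : ℂ) :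
    shiftHom (c + (p a).val) (signedInv (p a) (A a a)) *
        shiftHom (c - step (p a) + (p b).val) (signedInv (p b) (SuperYangian.schur a A b b)) =
      shiftHom (c + (p b).val) (signedInv (p b) (A b b)) *
        shiftHom (c - step (p b) + (p a).val)
          (signedInv (p a) (SuperYangian.schur b A a a)) := by
  have mixed : ∀ a ∈ s, ∀ b ∈ s, a ≠ b → p a = 0 → p b = 1 →
      shiftHom (c + (p a).val) (signedInv (p a) (A a a)) *
        shiftHom (c - step (p a) + (p b).val) (signedInv (p b) (SuperYangian.schur a A b b)) =
      shiftHom (c + (p b).val) (signedInv (p b) (A b b)) *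
        shiftHom (c - step (p b) + (p a).val)
          (signedInv (p a) (SuperYangian.schur b A a a)) := by
    intro a ha b hb hab hpa hpb
    have h1 := h.pivot_mul_mixed ha hb hpa hpb (c := c) (c' := c + 1) (by ring)
    rw [hpa, hpb, signedInv_zero, signedInv_one, signedInv_one, signedInv_zero,
      map_ringInverse _ (h.isUnit hb), map_ringInverse _ (h.isUnit_schur ha hb hab)]
    have e1 : c + ((0 : Fin 2).val : ℂ) = c := by simp
    have e2 : c + ((1 : Fin 2).val : ℂ) = c + 1 := by simp
    have e3 : c - step 0 + ((1 : Fin 2).val : ℂ) = c := by simp [step]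
    have e4 : c - step 1 + ((0 : Fin 2).val : ℂ) = c + 1 := by simp [step]
    rw [e1, e2, e3, e4]
    have u1 : IsUnit (shiftHom (c + 1) (A b b)) := (h.isUnit hb).map _
    have u2 : IsUnit (shiftHom c (SuperYangian.schur a A b b)) :=
      (h.isUnit_schur ha hb hab).map _
    rw [← u1.mul_right_inj, ← mul_assoc, ← mul_assoc, h1, Ring.mul_inverse_cancel _ u1, one_mul,
      mul_assoc, Ring.mul_inverse_cancel _ u2, mul_one]
  rcases parity_cases (p a) with hpa | hpa <;> rcases parity_cases (p b) with hpb | hpb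
  · rw [hpa, hpb]
    simp only [signedInv_zero]
    exact h.pivot_mul_same_symm ha hb (hpa.trans hpb.symm) (by simp [hpb])
  · exact mixed a ha b hb hab hpa hpb
  · exact (mixed b hb a ha hab.symm hpb hpa).symm
  -- For two odd indices each side is the inverse of a product of pivots in reversed order. Since a
  -- pivot commutes with the next one, the minor identity applies again.
  · have hab' := h.isUnit_schur ha hb hab
    have hba' := h.isUnit_schur hb ha hab.symm
    rw [hpa, hpb]
    simp only [signedInv_one]
    rw [map_ringInverse _ (h.isUnit ha), map_ringInverse _ (h.isUnit hb), map_ringInverse _ hab',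
      map_ringInverse _ hba', ← ringInverse_mul_of_isUnit (hab'.map _) ((h.isUnit ha).map _),
      ← ringInverse_mul_of_isUnit (hba'.map _) ((h.isUnit hb).map _),
      ← (h.commute_shift_schur ha hb hab _ _).eq, ← (h.commute_shift_schur hb ha hab.symm _ _).eq,
      h.pivot_mul_same_symm ha hb (hpa.trans hpb.symm) (by simp [hpb])]

lemma schur_schur {a b : ι} (ha : a ∈ s) (hb : b ∈ s) (hab : a ≠ b) :
    IsYangianBlock p ((s.erase a).erase b) (SuperYangian.schur b (SuperYangian.schur a A)) G :=
  (h.schur ha).schur (Finset.mem_erase.mpr ⟨hab.symm, hb⟩)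

end IsYangianBlock

/-- For an adjacent swap, the two leading factors agree by `pivotPair_comm` and the matrices passed
on to the tail agree by `schur_comm`; the accumulated shift only adds up the steps. -/
lemma pivotProd_perm {l l' : List ι} (hl : l.Perm l') :
    ∀ {s : Finset ι} {A : Matrix ι ι R⟦X⟧} (c : ℂ), IsYangianBlock p s A G → l.Nodup →
      (∀ x ∈ l, x ∈ s) → pivotProd p l A c = pivotProd p l' A c := by
  induction hl with
  | nil => intros; rfl
  | @cons a l l' hl ih =>
    intro s A c h hn hs
    obtain ⟨hal, hn⟩ := List.nodup_cons.mp hn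
    have ha : a ∈ s := hs a List.mem_cons_self
    rw [pivotProd, pivotProd, ih _ (h.schur ha) hn fun x hx => Finset.mem_erase.mpr
      ⟨fun hh => hal (hh ▸ hx), hs x (List.mem_cons_of_mem _ hx)⟩]
  | swap a b l =>
    intro s A c h hn hs
    have ha : a ∈ s := hs a (by simp)
    have hb : b ∈ s := hs b (by simp)
    have hab : a ≠ b := by
      rintro rfl
      simp at hn
    rw [pivotProd, pivotProd, pivotProd, pivotProd, ← mul_assoc, ← mul_assoc,
      h.pivotPair_comm ha hb hab, schur_comm (h.isUnit ha) (h.isUnit hb)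
      (h.isUnit_schur ha hb hab) (h.isUnit_schur hb ha hab.symm), sub_right_comm]
  | trans h₁ _ ih₁ ih₂ =>
    intro s A c h hn hs
    rw [ih₁ c h hn hs, ih₂ c h (h₁.nodup_iff.mp hn) fun x hx => hs x (h₁.mem_iff.mpr hx)]

/-- A constant that supercommutes with the entries of `A` commutes with the pivots. -/
lemma commute_pivotProd {χ : ι → ℤ} {τ : R} (hχ : ∀ k, χ k * χ k = 1) :
    ∀ {l : List ι} {s : Finset ι} {A : Matrix ι ι R⟦X⟧} (c : ℂ), IsYangianBlock p s A G →
      SuperCommOn χ s τ A → l.Nodup → (∀ x ∈ l, x ∈ s) →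
      Commute (C τ) (pivotProd p l A c) := by
  intro l
  induction l with
  | nil => intros; exact Commute.one_right _
  | cons a l ih =>
    intro s A c h hτ hn hs
    obtain ⟨hal, hn⟩ := List.nodup_cons.mp hn
    have ha : a ∈ s := hs a List.mem_cons_self
    have h1 : Commute (C τ) (A a a) := by
      have := congrArg (fun x => χ a • x) (hτ a ha a ha)
      simp only [smul_smul, hχ, one_smul] at this
      exact this
    have h2 : Commute (C τ) (signedInv (p a) (A a a)) := by
      rw [signedInv]
      split_ifs
      · exact h1
      · obtain ⟨u, hu⟩ := h.isUnit ha
        rw [← hu, Ring.inverse_unit]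
        rw [← hu] at h1
        exact h1.units_inv_right
    refine Commute.mul_right ?_ (ih _ (h.schur ha) (hτ.schur hχ ha (h.isUnit ha)) hn fun x hx =>
      Finset.mem_erase.mpr ⟨fun hh => hal (hh ▸ hx), hs x (List.mem_cons_of_mem _ hx)⟩)
    have := h2.map (shiftHom (c + (p a).val))
    rwa [shiftHom_C] at this

end berezinian

end SuperYangian

namespace SuperYangian

/-! ### The generating matrix T(u) satisfies RTT -/

section generators

variable {ι : Type*} [DecidableEq ι] (p : ι → Fin 2)

lemma rtt_relation (i j k l : ι) {r q : ℕ} (hr : 1 ≤ r) (hq : 1 ≤ q) :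
    t p i j r * t p k l q
        - (-1) ^ (((p i).val + (p j).val) * ((p k).val + (p l).val)) * (t p k l q * t p i j r) =
      (-1) ^ ((p i).val * (p j).val + (p i).val * (p k).val + (p j).val * (p k).val)
        * ∑ a ∈ Finset.range (min r q),
            (t p k j a * t p i l (r + q - 1 - a) - t p k j (r + q - 1 - a) * t p i l a) := by
  have h : mkHom p _ = mkHom p _ := RingQuot.mkAlgHom_rel ℂ (Rel.rtt (p := p) i j k l r q hr hq)
  simp only [map_sub, map_mul, map_pow, map_neg, map_one, map_sum] at h
  exact h

/-- The RTT relations in coefficients, including those for `t_{i,j}^{(0)}`. -/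
lemma superCommutator_t (i j k l : ι) (r q : ℕ) :
    (sgn (p i) (p k) * sgn (p j) (p k)) • (t p i j r * t p k l q) -
        (sgn (p i) (p l) * sgn (p j) (p l)) • (t p k l q * t p i j r) =
      sgn (p i) (p j) • ∑ a ∈ Finset.range (min r q),
        (t p k j a * t p i l (r + q - 1 - a) - t p k j (r + q - 1 - a) * t p i l a) := by
  rcases Nat.eq_zero_or_pos r with rfl | hr
  · rw [t_zero, Nat.zero_min, Finset.range_zero, Finset.sum_empty, smul_zero]
    split_ifs with h
    · subst h
      simp [sgn_mul_self]
    · simp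
  rcases Nat.eq_zero_or_pos q with rfl | hq
  · rw [t_zero, Nat.min_zero, Finset.range_zero, Finset.sum_empty, smul_zero]
    split_ifs with h
    · subst h
      simp
    · simp
  have h := rtt_relation p i j k l hr hq
  generalize ∑ a ∈ Finset.range (min r q),
    (t p k j a * t p i l (r + q - 1 - a) - t p k j (r + q - 1 - a) * t p i l a) = z at *
  generalize t p i j r * t p k l q = x at *
  generalize t p k l q * t p i j r = y at *
  generalize p i = a at *
  generalize p j = b at *
  generalize p k = c at *
  generalize p l = d at *
  rcases parity_cases a with rfl | rfl <;> rcases parity_cases b with rfl | rfl <;>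
    rcases parity_cases c with rfl | rfl <;> rcases parity_cases d with rfl | rfl <;>
    norm_num [sgn] at h ⊢ <;> first | exact h | linear_combination (norm := abel) -h

/-- Multiplication by v⁻¹ - u⁻¹ telescopes the finite sums of the presentation. -/
lemma isRTT_T (s : Finset ι) : IsRTT p s (T p) := by
  intro i _ j _ k _ l _
  have key : ∀ r q, coeff r (coeff q
      ((sgn (p i) (p k) * sgn (p j) (p k)) • (C (T p i j) * PowerSeries.map C (T p k l)) -
        (sgn (p i) (p l) * sgn (p j) (p l)) • (PowerSeries.map C (T p k l) * C (T p i j)))) =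
      sgn (p i) (p j) • ∑ a ∈ Finset.range (min r q),
        (t p k j a * t p i l (r + q - 1 - a) - t p k j (r + q - 1 - a) * t p i l a) := by
    intro r q
    rw [← superCommutator_t]
    simp only [map_sub, map_zsmul, USeries.coeff_coeff_C_mul_map_C,
      USeries.coeff_coeff_map_C_mul_C, T, Matrix.of_apply, coeff_mk]
  have key2 : ∀ r q, coeff r (coeff q (sgn (p i) (p j) • (C (T p k j) * PowerSeries.map C (T p i l) -
        PowerSeries.map C (T p k j) * C (T p i l)))) =
      sgn (p i) (p j) • (t p k j r * t p i l q - t p k j q * t p i l r) := by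
    intro r q
    simp only [map_sub, map_zsmul, USeries.coeff_coeff_C_mul_map_C,
      USeries.coeff_coeff_map_C_mul_C, T, Matrix.of_apply, coeff_mk]
  generalize (sgn (p i) (p k) * sgn (p j) (p k)) • (C (T p i j) * PowerSeries.map C (T p k l)) -
        (sgn (p i) (p l) * sgn (p j) (p l)) • (PowerSeries.map C (T p k l) * C (T p i j)) = f at *
  generalize sgn (p i) (p j) • (C (T p k j) * PowerSeries.map C (T p i l) -
        PowerSeries.map C (T p k j) * C (T p i l)) = g at *
  rw [USeries.varDiff, USeries.varMul, sub_mul, mul_assoc]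
  ext q r
  rw [map_sub, map_sub, coeff_C_mul]
  rcases q with _ | q <;> rcases r with _ | r
  · simp
  · rw [coeff_zero_X_mul, coeff_zero_X_mul, coeff_succ_X_mul, key]
    simp
  · rw [coeff_succ_X_mul, coeff_succ_X_mul, coeff_zero_X_mul, coeff_C_mul, coeff_zero_X_mul, key]
    simp
  · rw [coeff_succ_X_mul, coeff_succ_X_mul, coeff_succ_X_mul, coeff_C_mul, coeff_succ_X_mul, key,
      key, key2, ← smul_sub]
    congr 1
    have e1 : r + 1 + q - 1 = r + q := by omega
    have e2 : r + (q + 1) - 1 = r + q := by omega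
    rw [e1, e2]
    -- Both sums have the same summands, with upper limits min(r+1, q) and min(r, q+1). These limits
    -- differ by one, or agree when `r = q`, where the right side vanishes too.
    rcases lt_trichotomy r q with hh | hh | hh
    · rw [min_eq_left (show r + 1 ≤ q by omega), min_eq_left (show r ≤ q + 1 by omega),
        Finset.sum_range_succ, add_sub_cancel_left, Nat.add_sub_cancel_left]
    · subst hh
      rw [min_comm, sub_self, sub_self]
    · rw [min_eq_right (show q ≤ r + 1 by omega), min_eq_right (show q + 1 ≤ r by omega),
        Finset.sum_range_succ, sub_add_cancel_left, Nat.add_sub_cancel, neg_sub]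

lemma isYangianBlock_T [Fintype ι] : IsYangianBlock p Finset.univ (T p) (T' p) := by
  have h : InvOn Finset.univ (T p) (T' p) := by
    constructor
    · intro i _ j _
      rw [← Matrix.mul_apply, T', Ring.mul_inverse_cancel _ (isUnit_T p), Matrix.one_apply]
    · intro i _ j _
      rw [← Matrix.mul_apply, T', Ring.inverse_mul_cancel _ (isUnit_T p), Matrix.one_apply]
  exact ⟨h, fun i _ j _ => constantCoeff_T p i j, ((isRTT_T p _).mixed h).isInverseRTT h⟩

end generators

/-! ### Gauss decomposition by iterated Schur complements -/

section gauss

variable {n : ℕ} {R : Type*} [Ring R]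

/-- The matrix after elimination of the first `k` pivots. -/
def schurIter (A : Matrix (Fin n) (Fin n) R) : ℕ → Matrix (Fin n) (Fin n) R
  | 0 => A
  | k + 1 => if h : k < n then schur ⟨k, h⟩ (schurIter A k) else schurIter A k

lemma schurIter_succ (A : Matrix (Fin n) (Fin n) R) {k : ℕ} (h : k < n) :
    schurIter A (k + 1) = schur ⟨k, h⟩ (schurIter A k) := dif_pos h

lemma isYangianBlock_schurIter {p : Fin n → Fin 2} {A G : Matrix (Fin n) (Fin n) R⟦X⟧}
    (h : IsYangianBlock p Finset.univ A G) :
    ∀ k ≤ n, IsYangianBlock p (Finset.univ.filter fun i : Fin n => k ≤ i.val) (schurIter A k) G := by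
  intro k
  induction k with
  | zero => intro _; simpa [schurIter] using h
  | succ k ih =>
    intro hk
    rw [schurIter_succ A hk]
    have h1 := (ih (by omega)).schur (a := ⟨k, hk⟩) (by simp)
    convert h1 using 1
    ext i
    simp only [Finset.mem_filter, Finset.mem_univ, true_and, Finset.mem_erase, ne_eq, Fin.ext_iff]
    omega

lemma schurIter_eq_zero {A : Matrix (Fin n) (Fin n) R}
    (h : ∀ k : Fin n, IsUnit (schurIter A k k k)) :
    ∀ k ≤ n, ∀ i j : Fin n, (i.val < k ∨ j.val < k) → schurIter A k i j = 0 := by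
  intro k
  induction k with
  | zero => intro _ i j hij; simp at hij
  | succ k ih =>
    intro hk i j hij
    rw [schurIter_succ A hk]
    rcases hij with hi | hj
    · rcases Nat.lt_succ_iff_lt_or_eq.mp hi with hi | hi
      · exact schur_row_eq_zero (fun j => ih (by omega) i j (Or.inl hi)) j
      · obtain rfl : i = ⟨k, hk⟩ := Fin.ext hi
        exact schur_row_self (h ⟨k, hk⟩) j
    · rcases Nat.lt_succ_iff_lt_or_eq.mp hj with hj | hj
      · exact schur_col_eq_zero (fun i => ih (by omega) i j (Or.inr hj)) i
      · obtain rfl : j = ⟨k, hk⟩ := Fin.ext hj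
        exact schur_col_self (h ⟨k, hk⟩) i

/-- Step `k` subtracts column × pivot⁻¹ × row, and nothing is left after `n` steps; hence `A` is the
telescoping sum of these products, which is FDE. -/
lemma isGaussDecomposition_schurIter {A : Matrix (Fin n) (Fin n) R}
    (h : ∀ k : Fin n, IsUnit (schurIter A k k k)) :
    IsGaussDecomposition A
      (Matrix.of fun i k : Fin n => schurIter A k i k * Ring.inverse (schurIter A k k k))
      (Matrix.diagonal fun k : Fin n => schurIter A k k k)
      (Matrix.of fun k j : Fin n => Ring.inverse (schurIter A k k k) * schurIter A k k j) where
  lower_diag i := Ring.mul_inverse_cancel _ (h i)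
  lower_zero i j hij := by
    rw [Matrix.of_apply, schurIter_eq_zero h j j.2.le i j (Or.inl hij), zero_mul]
  diag := Matrix.isDiag_diagonal _
  upper_diag i := Ring.inverse_mul_cancel _ (h i)
  upper_zero i j hij := by
    rw [Matrix.of_apply, schurIter_eq_zero h i i.2.le i j (Or.inr hij), mul_zero]
  eq_mul := by
    ext i j
    rw [Matrix.mul_apply]
    have key : ∀ k : Fin n, (Matrix.of (fun i k : Fin n => schurIter A k i k *
        Ring.inverse (schurIter A k k k)) * Matrix.diagonal fun k : Fin n => schurIter A k k k) i k *
        Matrix.of (fun k j : Fin n => Ring.inverse (schurIter A k k k) * schurIter A k k j) k j =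
        schurIter A k i j - schurIter A (k + 1) i j := by
      intro k
      rw [Matrix.mul_diagonal, Matrix.of_apply, Matrix.of_apply, schurIter_succ A k.2, schur_apply,
        sub_sub_cancel, mul_assoc (schurIter A k i k), Ring.inverse_mul_cancel _ (h k), mul_one,
        mul_assoc]
    rw [Finset.sum_congr rfl fun k _ => key k,
      Fin.sum_univ_eq_sum_range (fun k => schurIter A k i j - schurIter A (k + 1) i j) n,
      Finset.sum_range_sub', schurIter_eq_zero h n le_rfl i j (Or.inl i.2), sub_zero, schurIter]

end gauss

lemma isUnit_schurIter_T {n : ℕ} (p : Fin n → Fin 2) (k : Fin n) :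
    IsUnit (schurIter (T p) k k k) :=
  (isYangianBlock_schurIter (isYangianBlock_T p) k k.2.le).isUnit (by simp)

lemma d_eq_schurIter {n : ℕ} (p : Fin n → Fin 2) (k : Fin n) :
    d p k = schurIter (T p) k k k := by
  rw [d_eq p (isGaussDecomposition_schurIter (isUnit_schurIter_T p)), Matrix.diagonal_apply_eq]

end SuperYangian

/-! ### The series b(u) as a pivot product -/

namespace ZeroOneSeq

open SuperYangian USeries

variable {M N : ℕ} (s : ZeroOneSeq M N)

/-- The accumulated shift before the position `k`. -/
def accShift : ℕ → ℂ
  | 0 => 0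
  | k + 1 => accShift k - if h : k < M + N then step (s.digit ⟨k, h⟩) else 0

lemma accShift_succ {k : ℕ} (h : k < M + N) :
    s.accShift (k + 1) = s.accShift k - step (s.digit ⟨k, h⟩) := by
  rw [accShift, dif_pos h]

/-- The rule for neighbouring digits is decoupled: every earlier zero contributes -1, every earlier
one +1, and the digit itself is added. -/
lemma offset_eq : ∀ (k : ℕ) (h : k < M + N),
    (s.offset k h : ℂ) = s.accShift k + ((s.digit ⟨k, h⟩).val : ℂ) := by
  intro k
  induction k with
  | zero => intro h; simp [offset, accShift]
  | succ k ih =>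
    intro h
    rw [offset, Int.cast_add, ih, accShift_succ s (by omega)]
    generalize s.digit ⟨k, _⟩ = a
    generalize s.digit ⟨k + 1, _⟩ = b
    rcases parity_cases a with rfl | rfl <;> rcases parity_cases b with rfl | rfl <;>
      simp [step, sub_eq_add_neg]

lemma b_eq_pivotProd :
    s.b = pivotProd s.digit (List.finRange (M + N)) (T s.digit) 0 := by
  have key : ∀ j k : ℕ, k + j = M + N →
      pivotProd s.digit ((List.finRange (M + N)).drop k) (schurIter (T s.digit) k) (s.accShift k) =
      ((List.ofFn fun i : Fin (M + N) =>
        USeries.shift (s.offset i i.isLt : ℂ) (s.dTilde i)).drop k).prod := by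
    intro j
    induction j with
    | zero =>
      intro k hk
      rw [List.drop_eq_nil_of_le (by simp [← hk]), List.drop_eq_nil_of_le (by simp [← hk]),
        pivotProd, List.prod_nil]
    | succ j ih =>
      intro k hk
      have hk' : k < M + N := by omega
      rw [List.drop_eq_getElem_cons (by simpa using hk'), List.drop_eq_getElem_cons
        (l := List.ofFn _) (by simpa using hk'), List.prod_cons, ← ih (k + 1) (by omega), List.getElem_finRange,
        List.getElem_ofFn, pivotProd, schurIter_succ _ hk', accShift_succ s hk', offset_eq,
        shift_eq_shiftHom, dTilde, d_eq_schurIter]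
      rfl
  have := key (M + N) 0 (by omega)
  rw [List.drop_zero, List.drop_zero] at this
  exact this.symm

end ZeroOneSeq

namespace SuperYangian

/-! ### Antisymmetry and Laplace expansion of alternating sums -/

section altSum

variable {S : Type*} [Ring S]

/-- The alternating sum of ordered products `∑ sgn(ρ) Y_{0,ρ(0)} Y_{1,ρ(1)} ⋯`. -/
def altSum {n : ℕ} (Y : Fin n → Fin n → S) : S :=
  ∑ ρ : Equiv.Perm (Fin n), (Equiv.Perm.sign ρ : ℤ) • (List.ofFn fun m => Y m (ρ m)).prod

/-- Isolates two consecutive factors. Since `x` and `y` do not depend on `g`, several products can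
be factored simultaneously. -/
lemma exists_prod_ofFn_eq {n : ℕ} (f : Fin (n + 1) → S) (m : Fin n) :
    ∃ x y : S, ∀ g : Fin (n + 1) → S, (∀ k, k ≠ m.castSucc → k ≠ m.succ → g k = f k) →
      (List.ofFn g).prod = x * (g m.castSucc * g m.succ) * y := by
  refine ⟨((List.ofFn f).take m).prod, ((List.ofFn f).drop (m + 2)).prod, fun g hg => ?_⟩
  have h1 : (List.ofFn g).take m = (List.ofFn f).take m := by
    refine List.ext_getElem (by simp) fun i hi _ => ?_
    have him : i < m := by simp at hi; omega
    rw [List.getElem_take, List.getElem_take, List.getElem_ofFn, List.getElem_ofFn]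
    exact hg _ (fun h => by simp [Fin.ext_iff] at h; omega)
      (fun h => by simp [Fin.ext_iff] at h; omega)
  have h2 : (List.ofFn g).drop (m + 2) = (List.ofFn f).drop (m + 2) := by
    refine List.ext_getElem (by simp) fun i hi _ => ?_
    rw [List.getElem_drop, List.getElem_drop, List.getElem_ofFn, List.getElem_ofFn]
    exact hg _ (fun h => by simp [Fin.ext_iff] at h; omega)
      (fun h => by simp [Fin.ext_iff] at h; omega)
  have hm := m.2
  rw [← h1, ← h2, ← List.prod_take_mul_prod_drop (List.ofFn g) m,
    List.drop_eq_getElem_cons (by simp), List.drop_eq_getElem_cons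
    (i := (m : ℕ) + 1) (by simp), List.prod_cons, List.prod_cons, List.getElem_ofFn,
    List.getElem_ofFn, mul_assoc, mul_assoc]
  rfl

/-- A family of row vectors, one for each position and label, subject to the exchange relation of
Manin matrices between consecutive positions. -/
def IsExchange {L : Type*} {n : ℕ} (X : Fin (n + 1) → L → Fin (n + 1) → S) : Prop :=
  ∀ (m : Fin n) (i k : L) (r q : Fin (n + 1)),
    X m.castSucc i r * X m.succ k q - X m.castSucc i q * X m.succ k r
      + X m.castSucc k r * X m.succ i q - X m.castSucc k q * X m.succ i r = 0

variable [Module ℂ S]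

lemma eq_zero_of_eq_neg {x : S} (h : x = -x) : x = 0 := by
  apply eq_of_two_smul
  rw [two_smul, smul_zero]
  nth_rewrite 1 [h]
  exact neg_add_cancel x

variable {L : Type*} {n : ℕ} {X : Fin (n + 1) → L → Fin (n + 1) → S}

/-- Twice an alternating sum pairs `ρ` with `ρ * w`. Doubling both sums and adding gives, for each
`ρ`, the four terms of one exchange relation between fixed outer factors. -/
lemma IsExchange.altSum_swap (hX : IsExchange X) (c : Fin (n + 1) → L) (m : Fin n) :
    altSum (fun k => X k (c (Equiv.swap m.castSucc m.succ k))) = -altSum fun k => X k (c k) := by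
  set w := Equiv.swap m.castSucc m.succ with hw
  have hwm : w m.castSucc = m.succ := Equiv.swap_apply_left _ _
  have hwm' : w m.succ = m.castSucc := Equiv.swap_apply_right _ _
  have hwo : ∀ k, k ≠ m.castSucc → k ≠ m.succ → w k = k := fun k h h' =>
    Equiv.swap_apply_of_ne_of_ne h h'
  have hsign : ∀ ρ : Equiv.Perm (Fin (n + 1)),
      (Equiv.Perm.sign (ρ * w) : ℤ) = -(Equiv.Perm.sign ρ : ℤ) := by
    intro ρ
    rw [map_mul, hw, Equiv.Perm.sign_swap (Fin.castSucc_lt_succ).ne]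
    simp
  have dbl : ∀ Y : Fin (n + 1) → Fin (n + 1) → S, altSum Y + altSum Y =
      ∑ ρ : Equiv.Perm (Fin (n + 1)), (Equiv.Perm.sign ρ : ℤ) •
        ((List.ofFn fun k => Y k (ρ k)).prod - (List.ofFn fun k => Y k (ρ (w k))).prod) := by
    intro Y
    simp only [smul_sub, Finset.sum_sub_distrib]
    rw [sub_eq_add_neg, ← Finset.sum_neg_distrib]
    congr 1
    rw [altSum, ← Equiv.sum_comp (Equiv.mulRight w)]
    refine Finset.sum_congr rfl fun ρ _ => ?_
    rw [Equiv.coe_mulRight, hsign, neg_smul]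
    rfl
  rw [eq_neg_iff_add_eq_zero]
  apply eq_of_two_smul
  rw [smul_zero, two_smul, add_add_add_comm, dbl, dbl, ← Finset.sum_add_distrib]
  refine Finset.sum_eq_zero fun ρ _ => ?_
  obtain ⟨x, y, hxy⟩ := exists_prod_ofFn_eq (fun k => X k (c k) (ρ k)) m
  rw [← smul_add, hxy _ (fun k h h' => by rw [hwo k h h']),
    hxy _ (fun k h h' => by rw [hwo k h h']), hxy _ (fun k _ _ => rfl),
    hxy _ (fun k h h' => by rw [hwo k h h'])]
  rw [hwm, hwm']
  have := congrArg (fun z => x * z * y)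
    (hX m (c m.succ) (c m.castSucc) (ρ m.castSucc) (ρ m.succ))
  simp only [mul_zero, zero_mul] at this
  rw [← sub_mul, ← mul_sub, ← sub_mul, ← mul_sub, ← add_mul, ← mul_add, ← add_sub_assoc, this,
    smul_zero]

lemma IsExchange.altSum_perm (hX : IsExchange X) (σ : Equiv.Perm (Fin (n + 1))) :
    ∀ c : Fin (n + 1) → L,
    altSum (fun k => X k (c (σ k))) = (Equiv.Perm.sign σ : ℤ) • altSum fun k => X k (c k) := by
  have hσ : σ ∈ Submonoid.closure (Set.range fun i : Fin n => Equiv.swap i.castSucc i.succ) := by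
    rw [Equiv.Perm.mclosure_swap_castSucc_succ]
    trivial
  induction hσ using Submonoid.closure_induction with
  | mem τ hτ =>
    obtain ⟨m, rfl⟩ := hτ
    intro c
    rw [hX.altSum_swap c m, Equiv.Perm.sign_swap (Fin.castSucc_lt_succ).ne]
    simp
  | one => intro c; simp
  | mul τ τ' _ _ ih ih' =>
    intro c
    have := ih' (fun k => c (τ k))
    rw [ih] at this
    rw [map_mul, Units.val_mul, mul_comm, mul_smul, ← this]
    rfl

/-- Transposing two equal labels changes the sign but not the sum. -/
lemma IsExchange.altSum_eq_zero (hX : IsExchange X) (c : Fin (n + 1) → L) {a b : Fin (n + 1)}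
    (hab : a ≠ b) (hc : c a = c b) : altSum (fun k => X k (c k)) = 0 := by
  apply eq_zero_of_eq_neg
  have h := hX.altSum_perm (Equiv.swap a b) c
  rw [Equiv.Perm.sign_swap hab] at h
  have h2 : ∀ k, c (Equiv.swap a b k) = c k := by
    intro k
    by_cases h1 : k = a
    · subst h1; rw [Equiv.swap_apply_left, hc]
    · by_cases h3 : k = b
      · subst h3; rw [Equiv.swap_apply_right, hc]
      · rw [Equiv.swap_apply_of_ne_of_ne h1 h3]
  simp only [h2] at h
  simpa using h

/-- The coefficient of the first factor in an alternating sum. -/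
def firstCofactor (Y : Fin n → Fin (n + 1) → S) (r : Fin (n + 1)) : S :=
  ∑ ρ : Equiv.Perm (Fin (n + 1)), if ρ 0 = r then
    (Equiv.Perm.sign ρ : ℤ) • (List.ofFn fun m : Fin n => Y m (ρ m.succ)).prod else 0

/-- The coefficient of the last factor in an alternating sum. -/
def lastCofactor (Y : Fin n → Fin (n + 1) → S) (r : Fin (n + 1)) : S :=
  ∑ ρ : Equiv.Perm (Fin (n + 1)), if ρ (Fin.last n) = r then
    (Equiv.Perm.sign ρ : ℤ) • (List.ofFn fun m : Fin n => Y m (ρ m.castSucc)).prod else 0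

lemma altSum_eq_sum_firstCofactor (Y : Fin (n + 1) → Fin (n + 1) → S) :
    altSum Y = ∑ r, Y 0 r * firstCofactor (fun m => Y m.succ) r := by
  simp only [firstCofactor, Finset.mul_sum, mul_ite, mul_zero]
  rw [Finset.sum_comm, altSum]
  refine Finset.sum_congr rfl fun ρ _ => ?_
  rw [Finset.sum_ite_eq, if_pos (Finset.mem_univ _), List.ofFn_succ, List.prod_cons, mul_smul_comm]

lemma altSum_eq_sum_lastCofactor (Y : Fin (n + 1) → Fin (n + 1) → S) :
    altSum Y = ∑ r, lastCofactor (fun m => Y m.castSucc) r * Y (Fin.last n) r := by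
  simp only [lastCofactor, Finset.sum_mul, ite_mul, zero_mul]
  rw [Finset.sum_comm, altSum]
  refine Finset.sum_congr rfl fun ρ _ => ?_
  rw [Finset.sum_ite_eq, if_pos (Finset.mem_univ _), List.ofFn_succ', List.concat_eq_append,
    List.prod_append, List.prod_singleton, smul_mul_assoc]

lemma firstCofactor_zero (Y : Fin n → Fin (n + 1) → S) :
    firstCofactor Y 0 = altSum fun m r => Y m r.succ := by
  rw [firstCofactor, ← Equiv.sum_comp Equiv.Perm.decomposeFin.symm, Fintype.sum_prod_type,
    Finset.sum_eq_single 0]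
  · refine Finset.sum_congr rfl fun e _ => ?_
    rw [if_pos (Equiv.Perm.decomposeFin_symm_apply_zero _ _),
      Equiv.Perm.decomposeFin.symm_sign, if_pos rfl, one_mul]
    simp only [Equiv.Perm.decomposeFin_symm_apply_succ, Equiv.swap_self, Equiv.refl_apply]
  · intro q _ hq
    refine Finset.sum_eq_zero fun e _ => ?_
    rw [if_neg]
    rwa [Equiv.Perm.decomposeFin_symm_apply_zero]
  · simp

/-- Conjugation by the rotation taking the last index to `0` preserves signs and reduces the claim
to `firstCofactor_zero`. -/
lemma lastCofactor_last (Y : Fin n → Fin (n + 1) → S) :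
    lastCofactor Y (Fin.last n) = altSum fun m r => Y m r.castSucc := by
  set c := finRotate (n + 1) with hc
  have c1 : c (Fin.last n) = 0 := finRotate_last
  have c2 : ∀ k : Fin n, c k.castSucc = k.succ := fun k => by
    rw [hc, finRotate_apply, Fin.coeSucc_eq_succ]
  have c3 : ∀ k : Fin n, c.symm k.succ = k.castSucc := fun k => by
    rw [Equiv.symm_apply_eq, c2]
  have h := firstCofactor_zero (fun m r => Y m (c.symm r))
  simp only [c3] at h
  rw [← h, lastCofactor, firstCofactor, ← Equiv.sum_comp (MulAut.conj c⁻¹).toEquiv]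
  refine Finset.sum_congr rfl fun ρ _ => ?_
  have e : ∀ k, (MulAut.conj c⁻¹).toEquiv ρ k = c.symm (ρ (c k)) := fun k => by
    simp
  have e2 : Equiv.Perm.sign ((MulAut.conj c⁻¹).toEquiv ρ) = Equiv.Perm.sign ρ := by
    simp only [MulEquiv.toEquiv_eq_coe, EquivLike.coe_coe, MulAut.conj_apply, inv_inv, map_mul,
      Equiv.Perm.sign_inv]
    rw [mul_right_comm, Int.units_mul_self, one_mul]
  simp only [e, e2, c1, c2]
  congr 1
  rw [Equiv.symm_apply_eq, c1]

end altSum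

/-! ### Quantum determinants as pivot products -/

section quantumDeterminants

variable {ι : Type*} [DecidableEq ι] {R : Type*} [Ring R] [Algebra ℂ R] {p : ι → Fin 2}
  {s : Finset ι} {A G : Matrix ι ι R⟦X⟧}

open USeries

/-- Successive Schur complements along a list of indices. -/
def schurList (l : List ι) (A : Matrix ι ι R⟦X⟧) : Matrix ι ι R⟦X⟧ :=
  l.foldl (fun B a => schur a B) A

lemma schurList_cons (a : ι) (l : List ι) (A : Matrix ι ι R⟦X⟧) :
    schurList (a :: l) A = schurList l (schur a A) := rfl

lemma pivotProd_append (l l' : List ι) :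
    ∀ (A : Matrix ι ι R⟦X⟧) (c : ℂ), pivotProd p (l ++ l') A c =
      pivotProd p l A c * pivotProd p l' (schurList l A) (c - (l.map fun a => step (p a)).sum) := by
  induction l with
  | nil => intro A c; simp [pivotProd, schurList]
  | cons a l ih =>
    intro A c
    rw [List.cons_append, pivotProd, pivotProd, ih, schurList_cons, List.map_cons, List.sum_cons,
      mul_assoc, sub_sub]

lemma IsYangianBlock.schurList {l : List ι} :
    ∀ {s : Finset ι} {A : Matrix ι ι R⟦X⟧}, IsYangianBlock p s A G → l.Nodup →
      (∀ x ∈ l, x ∈ s) → IsYangianBlock p (s \ l.toFinset) (schurList l A) G := by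
  induction l with
  | nil => intro s A h _ _; simpa [SuperYangian.schurList] using h
  | cons a l ih =>
    intro s A h hn hs
    obtain ⟨hal, hn⟩ := List.nodup_cons.mp hn
    have := ih (h.schur (hs a List.mem_cons_self)) hn fun x hx => Finset.mem_erase.mpr
      ⟨fun hh => hal (hh ▸ hx), hs x (List.mem_cons_of_mem _ hx)⟩
    rw [schurList_cons]
    convert this using 1
    ext x
    simp only [List.toFinset_cons, Finset.mem_sdiff, Finset.mem_insert, Finset.mem_erase]
    tauto

lemma schurList_row_eq_zero {i : ι} (l : List ι) : ∀ {A : Matrix ι ι R⟦X⟧}, (∀ j, A i j = 0) →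
    ∀ j, schurList l A i j = 0 := by
  induction l with
  | nil => exact fun h => h
  | cons a l ih => exact fun h => ih (schur_row_eq_zero h)

lemma IsYangianBlock.schurList_row {l : List ι} :
    ∀ {s : Finset ι} {A : Matrix ι ι R⟦X⟧}, IsYangianBlock p s A G → l.Nodup →
      (∀ x ∈ l, x ∈ s) → ∀ a ∈ l, ∀ j, SuperYangian.schurList l A a j = 0 := by
  induction l with
  | nil => simp
  | cons b l ih =>
    intro s A h hn hs a ha j
    obtain ⟨hal, hn⟩ := List.nodup_cons.mp hn
    have hb := hs b List.mem_cons_self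
    rcases List.mem_cons.mp ha with rfl | ha
    · exact schurList_row_eq_zero l (schur_row_self (h.isUnit hb)) j
    · exact ih (h.schur hb) hn (fun x hx => Finset.mem_erase.mpr
        ⟨fun hh => hal (hh ▸ hx), hs x (List.mem_cons_of_mem _ hx)⟩) a ha j

/-- Eliminating `a` subtracts right multiples of column `a` from the other columns, and the row
vector `K` annihilates column `a`. -/
lemma sum_mul_schurList {S κ : Type*} [Ring S] [Fintype κ] (φ : R⟦X⟧ →+* S) (K : κ → S)
    (f : κ → ι) (j : ι) (l : List ι) :
    ∀ {A : Matrix ι ι R⟦X⟧}, (∀ a ∈ l, ∑ r, K r * φ (A (f r) a) = 0) →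
      ∑ r, K r * φ (schurList l A (f r) j) = ∑ r, K r * φ (A (f r) j) := by
  induction l with
  | nil => intros; rfl
  | cons a l ih =>
    intro A h
    have key : ∀ b, ∑ r, K r * φ (schur a A (f r) b) = ∑ r, K r * φ (A (f r) b) := by
      intro b
      simp only [schur_apply, map_sub, map_mul, mul_sub, Finset.sum_sub_distrib, ← mul_assoc]
      rw [← Finset.sum_mul, ← Finset.sum_mul, h a List.mem_cons_self, zero_mul, zero_mul, sub_zero]
    rw [schurList_cons, ih fun b hb => (key b).trans (h b (List.mem_cons_of_mem _ hb)), key]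

/-- The quantum determinant of an even block is the shifted product of its pivots. -/
lemma IsYangianBlock.altSum_even (h : IsYangianBlock p s A G) :
    ∀ {n : ℕ} (f : Fin n → ι), Function.Injective f → (∀ k, f k ∈ s) → (∀ k, p (f k) = 0) →
      altSum (fun m r => shiftHom (-(m : ℂ)) (A (f r) (f m))) = pivotProd p (List.ofFn f) A 0 := by
  intro n
  induction n with
  | zero => intro f _ _ _; simp [altSum, pivotProd]
  | succ n ih =>
    intro f hf hs hp
    have hX : IsExchange (fun (m i r : Fin (n + 1)) => shiftHom (-(m : ℂ)) (A (f r) (f i))) := by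
      intro m i k r q
      have hc : -((m.castSucc : ℕ) : ℂ) - -((m.succ : ℕ) : ℂ) = step 0 := by simp [step]
      have r1 := h.isRTT.shift_step hc (hs r) (hs i) (hs q) (hs k) (hp r) (hp i) (hp q) (hp k)
      have r2 := h.isRTT.shift_step hc (hs r) (hs k) (hs q) (hs i) (hp r) (hp k) (hp q) (hp i)
      linear_combination (norm := abel) r1 + r2
    -- Pairing `K` with column `f j` replaces the last label by `j`. A repeated label gives zero, so
    -- `K` annihilates all columns but the last.
    set K := lastCofactor (fun (m : Fin n) r =>
      shiftHom (-((m.castSucc : ℕ) : ℂ)) (A (f r) (f m.castSucc))) with hK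
    have hexp : ∀ j, altSum (fun m r => shiftHom (-(m : ℂ))
        (A (f r) (f (if m = Fin.last n then j else m)))) =
        ∑ r, K r * shiftHom (-(n : ℂ)) (A (f r) (f j)) := by
      intro j
      rw [altSum_eq_sum_lastCofactor]
      simp only [Fin.castSucc_ne_last, if_false, if_true, Fin.val_last, hK]
    have hlast : altSum (fun m r => shiftHom (-(m : ℂ)) (A (f r) (f m))) =
        ∑ r, K r * shiftHom (-(n : ℂ)) (A (f r) (f (Fin.last n))) := by
      rw [← hexp]
      congr 1
      ext m r
      split_ifs with hm
      · rw [hm]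
      · rfl
    have hzero : ∀ j : Fin n, ∑ r, K r * shiftHom (-(n : ℂ)) (A (f r) (f j.castSucc)) = 0 := by
      intro j
      rw [← hexp]
      exact hX.altSum_eq_zero (fun m => if m = Fin.last n then j.castSucc else m)
        (Fin.castSucc_ne_last j) (by simp [Fin.castSucc_ne_last])
    have hn : (List.ofFn fun k : Fin n => f k.castSucc).Nodup :=
      List.nodup_ofFn.mpr (hf.comp (Fin.castSucc_injective n))
    have hmem : ∀ x ∈ List.ofFn (fun k : Fin n => f k.castSucc), x ∈ s := by
      intro x hx
      obtain ⟨k, rfl⟩ := (List.mem_ofFn' _ _).mp hx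
      exact hs _
    -- Eliminating the first `n` indices preserves the pairing with the last column and kills every
    -- row but the last. The smaller determinant times the last pivot is left.
    rw [List.ofFn_succ', List.concat_eq_append, pivotProd_append,
      ← ih (fun k => f k.castSucc) (hf.comp (Fin.castSucc_injective n)) (fun k => hs _)
        (fun k => hp _), hlast,
      ← sum_mul_schurList _ K f _ (List.ofFn fun k : Fin n => f k.castSucc) (by
        intro a ha
        obtain ⟨k, rfl⟩ := (List.mem_ofFn' _ _).mp ha
        exact hzero k),
      Finset.sum_eq_single (Fin.last n), hK, lastCofactor_last]
    · congr 1
      simp only [pivotProd, mul_one, hp, signedInv_zero, List.map_ofFn, Function.comp_def,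
        List.ofFn_const, List.sum_replicate]
      simp [step]
    · intro r _ hr
      obtain ⟨k, rfl⟩ := Fin.exists_castSucc_eq.mpr hr
      rw [h.schurList_row hn hmem _ ((List.mem_ofFn' _ _).mpr ⟨k, rfl⟩), map_zero, mul_zero]
    · simp

/-- The quantum determinant of the inverse of an odd block is the shifted product of the inverses
of its pivots. -/
lemma IsYangianBlock.altSum_odd :
    ∀ {n : ℕ} (f : Fin n → ι) {A : Matrix ι ι R⟦X⟧} (c : ℂ),
      IsYangianBlock p (Finset.univ.image f) A G → Function.Injective f → (∀ k, p (f k) = 1) →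
      altSum (fun m r => shiftHom (c + 1 + (m : ℂ)) (G (f m) (f r))) =
        pivotProd p (List.ofFn f) A c := by
  intro n
  induction n with
  | zero => intro f A c _ _ _; simp [altSum, pivotProd]
  | succ n ih =>
    intro f A c h hf hp
    have hs : ∀ k, f k ∈ Finset.univ.image f := fun k =>
      Finset.mem_image_of_mem _ (Finset.mem_univ k)
    have hX : IsExchange (fun (m i r : Fin (n + 1)) =>
        shiftHom (c + 1 + (m : ℂ)) (G (f i) (f r))) := by
      intro m i k r q
      have hc : (c + 1 + ((m.castSucc : ℕ) : ℂ)) - (c + 1 + ((m.succ : ℕ) : ℂ)) = step 1 := by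
        simp [step]
      have r1 := h.isInverseRTT.shift_step hc (hs i) (hs r) (hs k) (hs q) (hp i) (hp r) (hp k)
        (hp q)
      have r2 := h.isInverseRTT.shift_step hc (hs k) (hs r) (hs i) (hs q) (hp k) (hp r) (hp i)
        (hp q)
      linear_combination (norm := abel) r1 + r2
    set K := firstCofactor (fun (m : Fin n) r =>
      shiftHom (c + 1 + ((m.succ : ℕ) : ℂ)) (G (f m.succ) (f r))) with hK
    have hexp : ∀ j, altSum (fun m r => shiftHom (c + 1 + (m : ℂ))
        (G (f (if m = 0 then j else m)) (f r))) =
        ∑ r, shiftHom (c + 1) (G (f j) (f r)) * K r := by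
      intro j
      rw [altSum_eq_sum_firstCofactor]
      simp only [Fin.succ_ne_zero, if_false, if_true, hK]
      simp
    have hfirst : ∑ r, shiftHom (c + 1) (G (f 0) (f r)) * K r =
        altSum (fun m r => shiftHom (c + 1 + (m : ℂ)) (G (f m) (f r))) := by
      rw [← hexp]
      congr 1
      ext m r
      split_ifs with hm
      · rw [hm]
      · rfl
    have hzero : ∀ j : Fin (n + 1), j ≠ 0 → ∑ r, shiftHom (c + 1) (G (f j) (f r)) * K r = 0 := by
      intro j hj
      rw [← hexp]
      exact hX.altSum_eq_zero (fun m => if m = 0 then j else m) hj.symm (by simp [hj])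
    have hu : IsUnit (shiftHom (c + 1) (A (f 0) (f 0))) := (h.isUnit (hs 0)).map _
    -- Cramer's rule: `G` times `K` has only its `f 0` component nonzero, and the first row of the
    -- inverse matrix `A` recovers `K 0`. The index set is exactly the image of `f`, so that `A`
    -- inverts `G` there.
    have hK0 : shiftHom (c + 1) (A (f 0) (f 0)) *
        altSum (fun m r => shiftHom (c + 1 + (m : ℂ)) (G (f m) (f r))) = K 0 := by
      have h1 : ∑ j, shiftHom (c + 1) (A (f 0) (f j)) *
          ∑ r, shiftHom (c + 1) (G (f j) (f r)) * K r = K 0 := by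
        simp only [Finset.mul_sum, ← mul_assoc]
        rw [Finset.sum_comm]
        simp only [← Finset.sum_mul, ← map_mul, ← map_sum]
        have h2 : ∀ r, ∑ j, A (f 0) (f j) * G (f j) (f r) = if (0 : Fin (n + 1)) = r then 1 else 0 := by
          intro r
          rw [← Finset.sum_image (f := fun x => A (f 0) x * G x (f r)) hf.injOn,
            h.invOn.mul _ (hs 0) _ (hs r)]
          simp only [hf.eq_iff]
        simp only [h2]
        rw [Finset.sum_eq_single 0 (by intro r _ hr; simp [hr.symm]) (by simp)]
        simp
      rw [← h1, Finset.sum_eq_single 0 (by intro j _ hj; rw [hzero j hj, mul_zero]) (by simp),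
        hfirst]
    have himg : (Finset.univ.image f).erase (f 0) =
        Finset.univ.image fun k : Fin n => f k.succ := by
      ext x
      simp only [Finset.mem_erase, Finset.mem_image, Finset.mem_univ, true_and]
      constructor
      · rintro ⟨hx, k, rfl⟩
        obtain ⟨k', rfl⟩ := Fin.exists_succ_eq.mpr (fun hk : k = 0 => hx (by rw [hk]))
        exact ⟨k', rfl⟩
      · rintro ⟨k, rfl⟩
        exact ⟨fun hh => Fin.succ_ne_zero k (hf hh), k.succ, rfl⟩
    have hrec := ih (fun k => f k.succ) (A := SuperYangian.schur (f 0) A) (c + 1)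
      (by rw [← himg]; exact h.schur (hs 0)) (hf.comp (Fin.succ_injective n)) (fun k => hp _)
    rw [List.ofFn_succ, pivotProd, hp, signedInv_one, map_ringInverse _ (h.isUnit (hs 0)),
      show c - step 1 = c + 1 by simp [step], ← hrec, ← hu.mul_right_inj, ← mul_assoc]
    rw [show c + ((1 : Fin 2).val : ℂ) = c + 1 by simp, Ring.mul_inverse_cancel _ hu, one_mul, hK0,
      hK, firstCofactor_zero]
    congr 1
    ext m r
    rw [show c + 1 + ((m.succ : ℕ) : ℂ) = c + 1 + 1 + (m : ℂ) by push_cast [Fin.val_succ]; ring]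

end quantumDeterminants

end SuperYangian

namespace SuperYangian

/-! ### Bracket identities for the action of t_{ij}^{(1)} -/

section brackets

variable {S : Type*} [Ring S] {τ a b c d x y : S}

/-- The letters are the entries of a 2×2 block, primed ones at the second argument. The bracket with
`τ` is a derivation, and the Leibniz rule leaves db' - bd', which is zero by `h`. -/
lemma commute_minor {b' d' : S} (ha : τ * a - a * τ = -b) (hd : τ * d' - d' * τ = b')
    (hc : τ * c - c * τ = a - d) (hb : τ * b' - b' * τ = 0) (h : b * d' = d * b') :
    Commute τ (a * d' - c * b') := by
  have e : τ * (a * d' - c * b') - (a * d' - c * b') * τ = (τ * a - a * τ) * d' +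
      a * (τ * d' - d' * τ) - (τ * c - c * τ) * b' - c * (τ * b' - b' * τ) := by noncomm_ring
  have e2 : -b * d' + a * b' - (a - d) * b' - c * 0 = d * b' - b * d' := by noncomm_ring
  rw [ha, hd, hc, hb, e2, h, sub_self] at e
  exact sub_eq_zero.mp e

/-- With e = d - cxb one finds τe = eτ - exb, hence τy = yτ + xby. The extra term axby = by cancels
the one coming from τa = aτ - b. -/
lemma commute_pivot_ratio (hx : a * x = 1) (hx' : x * a = 1)
    (hy : (d - c * x * b) * y = 1) (hy' : y * (d - c * x * b) = 1)
    (ha : τ * a = a * τ - b) (hd : τ * d = d * τ - b)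
    (hc : τ * c = -(c * τ) - (a - d)) (hb : τ * b = -(b * τ)) : Commute τ (a * y) := by
  have h1 : τ * x = x * τ + x * b * x := by
    calc τ * x = (x * a) * τ * x := by rw [hx', one_mul]
      _ = x * (a * τ - b) * x + x * b * x := by noncomm_ring
      _ = x * τ * (a * x) + x * b * x := by rw [← ha]; noncomm_ring
      _ = _ := by rw [hx, mul_one]
  have h2 : τ * (c * x * b) = c * x * b * τ - b + (d - c * x * b) * x * b := by
    calc τ * (c * x * b) = (τ * c) * x * b := by noncomm_ring
      _ = -(c * (τ * x) * b) - (a * x) * b + d * x * b := by rw [hc]; noncomm_ring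
      _ = -(c * x * (τ * b)) - c * x * b * x * b - b + d * x * b := by rw [h1, hx]; noncomm_ring
      _ = _ := by rw [hb]; noncomm_ring
  have h3 : τ * (d - c * x * b) = (d - c * x * b) * τ - (d - c * x * b) * x * b := by
    rw [mul_sub, hd, h2]; noncomm_ring
  generalize d - c * x * b = e at *
  have h4 : τ * y = y * τ + x * b * y := by
    calc τ * y = (y * e) * τ * y := by rw [hy', one_mul]
      _ = y * (e * τ - e * x * b) * y + (y * e) * x * b * y := by noncomm_ring
      _ = y * τ * (e * y) + x * b * y := by rw [← h3, hy']; noncomm_ring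
      _ = _ := by rw [hy, mul_one]
  change τ * (a * y) = a * y * τ
  calc τ * (a * y) = (τ * a) * y := by noncomm_ring
    _ = a * (τ * y) - b * y := by rw [ha]; noncomm_ring
    _ = a * y * τ + (a * x) * b * y - b * y := by rw [h4]; noncomm_ring
    _ = _ := by rw [hx]; noncomm_ring

end brackets

/-! ### Centrality of the pivot product -/

section zeroModes

variable {ι : Type*} [DecidableEq ι] (p : ι → Fin 2)

open USeries

/-- The action of `t_{i,j}^{(1)}` on the generating series. -/
lemma zeroMode (i j k l : ι) :
    (sgn (p i) (p k) * sgn (p j) (p k)) • (C (t p i j 1) * T p k l) -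
        (sgn (p i) (p l) * sgn (p j) (p l)) • (T p k l * C (t p i j 1)) =
      sgn (p i) (p j) • ((if k = j then T p i l else 0) - if i = l then T p k j else 0) := by
  ext q
  have h := superCommutator_t p i j k l 1 q
  have e : coeff q ((if k = j then T p i l else 0) - if i = l then T p k j else 0) =
      ∑ a ∈ Finset.range (min 1 q),
        (t p k j a * t p i l (1 + q - 1 - a) - t p k j (1 + q - 1 - a) * t p i l a) := by
    rw [map_sub, apply_ite (coeff q), apply_ite (coeff q), map_zero]
    simp only [T, Matrix.of_apply, coeff_mk]
    rcases Nat.eq_zero_or_pos q with rfl | hq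
    · simp only [t_zero, Nat.min_zero, Finset.range_zero, Finset.sum_empty]
      split_ifs <;> simp_all
    · rw [min_eq_left hq, Finset.sum_range_one, Nat.add_sub_cancel_left, Nat.sub_zero, t_zero,
        t_zero]
      split_ifs <;> simp
  rw [map_zsmul, e, ← h]
  simp only [map_sub, map_zsmul, coeff_C_mul, coeff_mul_C, T, Matrix.of_apply, coeff_mk]

lemma zsmul_sgn_cancel {M : Type*} [AddCommGroup M] (e : Fin 2) (x : M) :
    sgn e e • sgn e e • x = x := by
  rw [smul_smul, sgn_mul_self, one_smul]

variable [Fintype ι]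

/-- `t_{i,j}^{(1)}` commutes with the product of the first two pivots when `i`, `j` are eliminated
first. -/
lemma commute_zeroMode_pivotPair {i j : ι} (hij : i ≠ j) (c : ℂ) :
    Commute (C (t p i j 1)) (shiftHom (c + (p i).val) (signedInv (p i) (T p i i)) *
      shiftHom (c - step (p i) + (p j).val) (signedInv (p j) (schur i (T p) j j))) := by
  have h := isYangianBlock_T p
  have hi := Finset.mem_univ i
  have hj := Finset.mem_univ j
  have ua := h.isUnit hi
  have uD := h.isUnit_schur hi hj hij
  have z1 := zeroMode p i j i i
  have z2 := zeroMode p i j i j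
  have z3 := zeroMode p i j j i
  have z4 := zeroMode p i j j j
  simp only [hij, if_true, if_false] at z1 z2 z3 z4
  have shiftComm : ∀ {z : (SuperYangian p)⟦X⟧} (c : ℂ), Commute (C (t p i j 1)) z →
      Commute (C (t p i j 1)) (shiftHom c z) := by
    intro z c hz
    have := hz.map (shiftHom c)
    rwa [shiftHom_C] at this
  have invComm : ∀ {z : (SuperYangian p)⟦X⟧}, IsUnit z → Commute (C (t p i j 1)) z →
      Commute (C (t p i j 1)) (Ring.inverse z) := by
    rintro z ⟨u, rfl⟩ hz
    rw [Ring.inverse_unit]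
    exact hz.units_inv_right
  by_cases hp : p i = p j
  · rw [hp] at z1 z2 z3 z4
    simp only [sgn_mul_self, one_smul, sub_zero, zero_sub, sub_self, smul_zero] at z1 z2 z3 z4
    have key : ∀ c c' : ℂ, c - c' = step (p j) → Commute (C (t p i j 1))
        (shiftHom c (T p i i) * shiftHom c' (schur i (T p) j j)) := by
      intro c c' hc
      rw [h.pivot_mul_same hi hj hp hc]
      have hr := h.isRTT.shift_step hc hi hj hj hj hp rfl rfl rfl
      -- Placing the same sign on both off-diagonal entries leaves their product unchanged and gives
      -- the brackets the form required by `commute_minor`.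
      have e1 : shiftHom c (T p j i) * shiftHom c' (T p i j) =
          (sgn (p j) (p j) • shiftHom c (T p j i)) *
            (sgn (p j) (p j) • shiftHom c' (T p i j)) := by
        rw [smul_mul_smul_comm, sgn_mul_self, one_smul]
      rw [e1]
      have y1 := congrArg (shiftHom c) z1
      have y2 := congrArg (shiftHom c') z2
      have y3 := congrArg (shiftHom c) z3
      have y4 := congrArg (shiftHom c') z4
      simp only [map_sub, map_mul, map_zsmul, shiftHom_C, map_neg, map_zero] at y1 y2 y3 y4
      refine commute_minor (b := sgn (p j) (p j) • shiftHom c (T p i j))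
        (d := shiftHom c (T p j j)) ?_ y4 ?_ ?_ ?_
      · rw [y1, smul_neg]
      · rw [mul_smul_comm, smul_mul_assoc, ← smul_sub, y3, zsmul_sgn_cancel]
      · rw [mul_smul_comm, smul_mul_assoc, ← smul_sub, y2, smul_zero]
      · rw [mul_smul_comm, smul_mul_assoc, sub_left_injective.eq_iff.mp hr]
    rw [hp]
    rcases parity_cases (p j) with hpj | hpj
    · rw [hpj]
      simp only [signedInv_zero]
      exact key _ _ (by simp [hpj])
    · rw [hpj]
      simp only [signedInv_one]
      rw [map_ringInverse _ ua, map_ringInverse _ uD,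
        ← ringInverse_mul_of_isUnit (uD.map _) (ua.map _),
        ← (h.commute_shift_schur hi hj hij _ _).eq]
      exact invComm ((ua.map _).mul (uD.map _)) (key _ _ (by simp [hpj]))
  · have key : Commute (C (t p i j 1)) (T p i i * Ring.inverse (schur i (T p) j j)) := by
      have e1 : schur i (T p) j j = T p j j - (sgn (p i) (p i) • T p j i) *
          Ring.inverse (T p i i) * (sgn (p i) (p i) • T p i j) := by
        rw [schur_apply]
        simp only [smul_mul_assoc, mul_smul_comm, zsmul_sgn_cancel]
      rw [e1] at uD ⊢
      refine commute_pivot_ratio (Ring.mul_inverse_cancel _ ua) (Ring.inverse_mul_cancel _ ua)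
        (Ring.mul_inverse_cancel _ uD) (Ring.inverse_mul_cancel _ uD) ?_ ?_ ?_ ?_
      all_goals
        rcases parity_cases (p i) with hpi | hpi <;> rcases parity_cases (p j) with hpj | hpj <;>
        first
        | exact absurd (hpi.trans hpj.symm) hp
        | (simp only [hpi, hpj, sgn_zero_left, sgn_zero_right, sgn_one_one, one_smul, neg_smul,
            mul_one, sub_zero, zero_sub, sub_self, neg_mul, mul_neg] at z1 z2 z3 z4 ⊢
           first
           | linear_combination (norm := abel1) z1
           | linear_combination (norm := abel1) z2
           | linear_combination (norm := abel1) z3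
           | linear_combination (norm := abel1) z4
           | linear_combination (norm := abel1) -z1
           | linear_combination (norm := abel1) -z2
           | linear_combination (norm := abel1) -z3
           | linear_combination (norm := abel1) -z4)
    -- For opposite parities both pivots occur at the same argument, so commutation before the shift
    -- suffices.
    have hcomm := h.commute_shift_schur hi hj hij
    rcases parity_cases (p i) with hpi | hpi <;> rcases parity_cases (p j) with hpj | hpj
    · exact absurd (hpi.trans hpj.symm) hp
    · rw [hpi, hpj, signedInv_zero, signedInv_one,
        show c - step 0 + ((1 : Fin 2).val : ℂ) = c + ((0 : Fin 2).val : ℂ) by simp [step],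
        ← map_mul]
      exact shiftComm _ key
    · rw [hpi, hpj, signedInv_zero, signedInv_one,
        show c - step 1 + ((0 : Fin 2).val : ℂ) = c + ((1 : Fin 2).val : ℂ) by simp [step],
        map_ringInverse _ ua]
      have h1 := invComm (ua.mul uD.ringInverse) key
      have h2 := shiftComm (c + ((1 : Fin 2).val : ℂ)) h1
      have e2 : ∀ x y : (SuperYangian p)⟦X⟧, IsUnit x → IsUnit y → Commute x y →
          Ring.inverse (x * Ring.inverse y) = Ring.inverse x * y := by
        rintro _ _ ⟨x, rfl⟩ ⟨y, rfl⟩ hxy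
        rw [Ring.inverse_unit, ← Units.val_mul, Ring.inverse_unit, Ring.inverse_unit, mul_inv_rev,
          inv_inv, Units.val_mul]
        exact hxy.symm.units_inv_right.eq
      rw [map_ringInverse _ (ua.mul uD.ringInverse), map_mul, map_ringInverse _ uD,
        e2 _ _ (ua.map _) (uD.map _) (hcomm _ _)] at h2
      exact h2
    · exact absurd (hpi.trans hpj.symm) hp

/-- The coefficients of `t_{i,i}(u)` commute. -/
lemma commute_t_self (i : ι) (r q : ℕ) : Commute (t p i i r) (t p i i q) := by
  have h := isRTT_T p Finset.univ i (Finset.mem_univ i) i (Finset.mem_univ i) i (Finset.mem_univ i)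
    i (Finset.mem_univ i)
  rw [sgn_mul_self, one_smul, one_smul, mul_smul_comm] at h
  -- With all indices equal, the right side of RTT is a sign times the bracket itself.
  have h2 := congrArg (fun x => coeff r (coeff q x)) (eq_zero_of_varDiff_mul _ h)
  simp only [map_sub, coeff_coeff_C_mul_map_C, coeff_coeff_map_C_mul_C, map_zero, T, Matrix.of_apply,
    coeff_mk] at h2
  exact sub_eq_zero.mp h2

/-- Up to sign, the commutator of `t_{ii}^{(r+1)}` with `t_{ij}^{(1)}` is `t_{ij}^{(r+1)}`. -/
lemma mem_of_generators (B : Subalgebra ℂ (SuperYangian p)) (h₁ : ∀ i r, t p i i r ∈ B)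
    (h₂ : ∀ i j, i ≠ j → t p i j 1 ∈ B) (y : SuperYangian p) : y ∈ B := by
  have ht : ∀ i j r, t p i j (r + 1) ∈ B := by
    intro i j r
    by_cases hij : i = j
    · subst hij; exact h₁ _ _
    have h := superCommutator_t p i i i j (r + 1) 1
    rw [sgn_mul_self, sgn_mul_self, one_smul, one_smul, min_eq_right (by omega),
      Finset.sum_range_one, Nat.sub_zero, Nat.add_sub_cancel, t_zero, t_zero, if_pos rfl,
      if_neg hij, one_mul, mul_zero, sub_zero] at h
    rw [← zsmul_sgn_cancel (p i) (t p i j (r + 1)), ← h]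
    exact zsmul_mem (sub_mem (mul_mem (h₁ _ _) (h₂ _ _ hij)) (mul_mem (h₂ _ _ hij) (h₁ _ _))) _
  obtain ⟨x, rfl⟩ : ∃ x, mkHom p x = y := RingQuot.mkAlgHom_surjective ℂ (Rel p) y
  induction x using FreeAlgebra.induction with
  | grade0 z => rw [AlgHom.commutes]; exact B.algebraMap_mem z
  | grade1 z => exact ht z.1 z.2.1 z.2.2
  | mul a b ha hb => rw [map_mul]; exact mul_mem ha hb
  | add a b ha hb => rw [map_add]; exact add_mem ha hb

/-- The shifted product of all pivots is central. -/
lemma coeff_pivotProd_mem_center {l : List ι} (hn : l.Nodup) (hl : ∀ i, i ∈ l) (c : ℂ) (r : ℕ) :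
    coeff r (pivotProd p l (T p) c) ∈ Subalgebra.center ℂ (SuperYangian p) := by
  have h := isYangianBlock_T p
  have reduce : ∀ τ : SuperYangian p, Commute (C τ) (pivotProd p l (T p) c) →
      τ ∈ Subalgebra.centralizer ℂ {coeff r (pivotProd p l (T p) c)} := by
    intro τ hτ
    rw [Subalgebra.mem_centralizer_iff]
    rintro _ rfl
    have := congrArg (coeff r) hτ.eq
    rw [coeff_C_mul, coeff_mul_C] at this
    exact this.symm
  rw [Subalgebra.mem_center_iff]
  intro y
  have hy := mem_of_generators p
    (Subalgebra.centralizer ℂ {coeff r (pivotProd p l (T p) c)}) ?_ ?_ y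
  · exact (Subalgebra.mem_centralizer_iff ℂ |>.mp hy _ rfl).symm
  · intro i q
    apply reduce
    -- With `i` first, the generator commutes with the pivot t_{ii}(u) and with the Schur complement
    -- that carries the remaining pivots.
    have hperm : l.Perm (i :: l.erase i) := List.perm_cons_erase (hl i)
    have hn' := hperm.nodup_iff.mp hn
    rw [pivotProd_perm hperm c h hn fun x _ => Finset.mem_univ x, pivotProd]
    have h0 : ∀ r, Commute (C (coeff r (C (t p i i q)))) (T p i i) := by
      intro r
      rw [coeff_C]
      split_ifs
      · ext m
        rw [coeff_C_mul, coeff_mul_C]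
        simpa [T] using (commute_t_self p i q m).eq
      · rw [map_zero]; exact Commute.zero_left _
    have hT : Commute (C (t p i i q)) (T p i i) := commute_of_forall_coeff h0
    refine Commute.mul_right ?_ ?_
    · have h1 : Commute (C (t p i i q)) (signedInv (p i) (T p i i)) := by
        rw [signedInv]
        split_ifs
        · exact hT
        · obtain ⟨u, hu⟩ := h.isUnit (Finset.mem_univ i)
          rw [← hu, Ring.inverse_unit]
          rw [← hu] at hT
          exact hT.units_inv_right
      have := h1.map (shiftHom (c + (p i).val))
      rwa [shiftHom_C] at this
    · have hχ := (h.isMixedRTT.superCommOn (Finset.mem_univ i) (Finset.mem_univ i)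
        (Finset.erase_subset i _) (by simp) (by simp) q).of_inverse
        (h.schur (Finset.mem_univ i)).invOn
      rw [show coeff q (T p i i) = t p i i q by simp [T]] at hχ
      refine commute_pivotProd (fun k => by rw [sgn_mul_self, one_mul]) _
        (h.schur (Finset.mem_univ i)) hχ (List.nodup_cons.mp hn').2 fun x hx => ?_
      exact Finset.mem_erase.mpr ⟨fun hh => (List.nodup_cons.mp hn').1 (hh ▸ hx),
        Finset.mem_univ x⟩
  · intro i j hij
    apply reduce
    -- With `i`, `j` first, the first two pivots are handled together; the later ones have indices
    -- disjoint from `i`, `j`.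
    have hperm : l.Perm (i :: j :: (l.erase i).erase j) :=
      (List.perm_cons_erase (hl i)).trans
        ((List.perm_cons_erase ((List.mem_erase_of_ne hij.symm).mpr (hl j))).cons i)
    have hn' := hperm.nodup_iff.mp hn
    rw [pivotProd_perm hperm c h hn fun x _ => Finset.mem_univ x, pivotProd, pivotProd, ← mul_assoc]
    refine Commute.mul_right (commute_zeroMode_pivotPair p hij c) ?_
    have hb := h.schur_schur (Finset.mem_univ i) (Finset.mem_univ j) hij
    have hχ := (h.isMixedRTT.superCommOn (Finset.mem_univ i) (Finset.mem_univ j)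
      (((Finset.erase_subset j _).trans (Finset.erase_subset i _))) (by simp) (by simp)
      1).of_inverse hb.invOn
    rw [show coeff 1 (T p i j) = t p i j 1 by simp [T]] at hχ
    refine commute_pivotProd (fun k => ?_) _ hb hχ
      (List.nodup_cons.mp (List.nodup_cons.mp hn').2).2 fun x hx => ?_
    · rw [mul_mul_mul_comm, sgn_mul_self, sgn_mul_self, one_mul]
    · simp only [List.nodup_cons, List.mem_cons, not_or] at hn'
      exact Finset.mem_erase.mpr ⟨fun hh => hn'.2.1 (hh ▸ hx), Finset.mem_erase.mpr
        ⟨fun hh => hn'.1.2 (hh ▸ hx), Finset.mem_univ x⟩⟩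

end zeroModes

end SuperYangian

/-! ### Assembling the quantum Berezinian -/

namespace ZeroOneSeq

open SuperYangian USeries

variable {M N : ℕ} (s : ZeroOneSeq M N)

lemma digit_zeroPos (k : Fin M) : s.digit (s.zeroPos k) = 0 :=
  (Finset.mem_filter.mp (Finset.orderEmbOfFin_mem _ s.card_zero k)).2

lemma digit_onePos (k : Fin N) : s.digit (s.onePos k) = 1 :=
  (Finset.mem_filter.mp (Finset.orderEmbOfFin_mem _ s.card_one k)).2

lemma zeroPos_injective : Function.Injective s.zeroPos :=
  (Finset.orderEmbOfFin _ s.card_zero).injective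

lemma onePos_injective : Function.Injective s.onePos :=
  (Finset.orderEmbOfFin _ s.card_one).injective

lemma exists_zeroPos_eq {i : Fin (M + N)} (h : s.digit i = 0) : ∃ k, s.zeroPos k = i := by
  have : i ∈ Set.range (Finset.orderEmbOfFin _ s.card_zero) := by
    rw [Finset.range_orderEmbOfFin]; simpa using h
  exact this

lemma exists_onePos_eq {i : Fin (M + N)} (h : s.digit i = 1) : ∃ k, s.onePos k = i := by
  have : i ∈ Set.range (Finset.orderEmbOfFin _ s.card_one) := by
    rw [Finset.range_orderEmbOfFin]; simpa using h
  exact this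

lemma finRange_perm :
    (List.finRange (M + N)).Perm (List.ofFn s.zeroPos ++ List.ofFn s.onePos) := by
  refine (List.perm_ext_iff_of_nodup (List.nodup_finRange _) ?_).mpr fun i => ?_
  · refine List.nodup_append.mpr ⟨List.nodup_ofFn.mpr s.zeroPos_injective,
      List.nodup_ofFn.mpr s.onePos_injective, fun a ha b hb hab => ?_⟩
    obtain ⟨k, rfl⟩ := (List.mem_ofFn' _ _).mp ha
    obtain ⟨k', rfl⟩ := (List.mem_ofFn' _ _).mp hb
    have := congrArg s.digit hab
    rw [digit_zeroPos, digit_onePos] at this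
    exact zero_ne_one this
  · refine iff_of_true (List.mem_finRange i) (List.mem_append.mpr ?_)
    rcases parity_cases (s.digit i) with h | h
    · exact Or.inl ((List.mem_ofFn' _ _).mpr (s.exists_zeroPos_eq h))
    · exact Or.inr ((List.mem_ofFn' _ _).mpr (s.exists_onePos_eq h))

lemma qsdet_eq_altSum : s.qsdet =
    altSum (fun m r => shiftHom (-(m : ℂ)) (T s.digit (s.zeroPos r) (s.zeroPos m))) *
      altSum (fun m r => shiftHom (-(M : ℂ) + 1 + (m : ℂ))
        (T' s.digit (s.onePos m) (s.onePos r))) := by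
  simp only [qsdet, altSum, shift_eq_shiftHom]

/-- The zeros are eliminated first. The remaining odd block is inverse to the odd block of `T'`, and
the `M` even steps have brought the shift to -M, the starting point of the second determinant. -/
lemma b_eq_qsdet : s.b = s.qsdet := by
  have h := isYangianBlock_T s.digit
  have hz : ∀ x ∈ List.ofFn s.zeroPos, x ∈ Finset.univ := fun x _ => Finset.mem_univ x
  have hblock := h.schurList (List.nodup_ofFn.mpr s.zeroPos_injective) hz
  have himg : Finset.univ \ (List.ofFn s.zeroPos).toFinset = Finset.univ.image s.onePos := by
    ext i
    simp only [Finset.mem_sdiff, Finset.mem_univ, true_and, List.mem_toFinset, Finset.mem_image]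
    constructor
    · intro hi
      rcases parity_cases (s.digit i) with h | h
      · exact absurd ((List.mem_ofFn' _ _).mpr (s.exists_zeroPos_eq h)) hi
      · exact s.exists_onePos_eq h
    · rintro ⟨k, rfl⟩ hk
      obtain ⟨k', hk'⟩ := (List.mem_ofFn' _ _).mp hk
      have := congrArg s.digit hk'
      rw [digit_zeroPos, digit_onePos] at this
      exact zero_ne_one this
  rw [himg] at hblock
  have hsum : (0 : ℂ) - ((List.ofFn s.zeroPos).map fun a => step (s.digit a)).sum = -(M : ℂ) := by
    simp only [List.map_ofFn, Function.comp_def, digit_zeroPos, List.ofFn_const,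
      List.sum_replicate]
    simp [step]
  rw [b_eq_pivotProd, pivotProd_perm s.finRange_perm 0 h (List.nodup_finRange _)
    (fun x _ => Finset.mem_univ x), pivotProd_append, hsum, qsdet_eq_altSum,
    h.altSum_even s.zeroPos s.zeroPos_injective (fun k => Finset.mem_univ _) s.digit_zeroPos,
    IsYangianBlock.altSum_odd s.onePos (-(M : ℂ)) hblock s.onePos_injective s.digit_onePos]

end ZeroOneSeq

end

/-- The series `b(u)` built from the Drinfeld generators equals the quantum Berezinian; in
particular its coefficients are central. -/
theorem mainTheorem2 (M N : ℕ) (s : ZeroOneSeq M N) :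
    s.b = s.qsdet ∧
      ∀ r : ℕ, 1 ≤ r → PowerSeries.coeff r s.b ∈ Subalgebra.center ℂ s.Y := by
  refine ⟨s.b_eq_qsdet, fun r _ => ?_⟩
  rw [s.b_eq_pivotProd]
  exact SuperYangian.coeff_pivotProd_mem_center s.digit (List.nodup_finRange _)
    List.mem_finRange 0 r
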